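/- **Setting.** Let $\mathbb K=\mathbb R$ or $\mathbb C$, and let $M\in\mathbb K^{n\times n}$ be unitary. Consider on $\mathbb K^n$ either the bilinear form $\langle x,y\rangle_M=y^TMx$ with $M^T=\pm M$ (then $*=T$), or the sesquilinear form $\langle x,y\rangle_M=y^HMx$ with $M^H=\pm M$ (then $*=H$). The adjoint of $A\in\mathbb K^{n\times n}$ is $A^\star=M^{-1}A^*M$. Let $\mathbb S$ be the Jordan algebra $\{A: A^\star=A\}$ or the Lie algebra $\{A:A^\star=-A\}$, and put $M\mathbb S=\{MA:A\in\mathbb S\}$. Then $M\mathbb S$ is one of the sets $\mathsf{sym}$ ($A^T=A$), $\mathsf{skew\text{-}sym}$ ($A^T=-A$), $\mathsf{Herm}$ ($A^H=A$), $\mathsf{skew\text{-}Herm}$ ($A^H=-A$), the last being considered in the spectral part below only for $\mathbb K=\mathbb C$. Put $*=T$ if $M\mathbb S\in\{\mathsf{sym},\mathsf{skew\text{-}sym}\}$ and $*=H$ if $M\mathbb S\in\{\mathsf{Herm},\mathsf{skew\text{-}Herm}\}$; put $\varepsilon=1$ if $M\mathbb S\in\{\mathsf{sym},\mathsf{Herm}\}$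 and $\varepsilon=-1$ otherwise. For $X,B\in\mathbb K^{n\times p}$ let $\mathbb S(X,B)=\{A\in\mathbb S: AX=B\}$ and, for a given norm, $\sigma^{\mathbb S}(X,B)=\inf\{\|A\|:A\in\mathbb S(X,B)\}$; write $\sigma^{\mathrm{unstruc}}$ for $\mathbb S=\mathbb K^{n\times n}$. Let $X^\dagger$ be the Moore–Penrose pseudoinverse of $X$, and $$\mathcal F_*^{\varepsilon}(X,B)=BX^\dagger+\varepsilon(BX^\dagger)^*-(X^\dagger)^*X^*BX^\dagger .$$ **Theorem.** Suppose $\mathbb S(X,B)\neq\emptyset$. Then $A\in\mathbb S(X,B)$ if and only if $$A=M^{-1}\mathcal F^\varepsilon_*(X,MB)+M^{-1}(I-XX^\dagger)^*Z(I-XX^\dagger)\quad\text{for some } Z\in M\mathbb S$$ (for $*=H$ one has $(I-XX^\dagger)^*=I-XX^\dagger$). **(a) Frobenius norm.** $A_o=M^{-1}\mathcal F_*^\varepsilon(X,MB)$ is the unique matrix in $\mathbb S(X,B)$ with $\|A_o\|_F=\sigma^{\mathbb S}(X,B)$, and $$\|A_o\|_F=\sqrt{2\|BX^\dagger\|_F^2-\mathrm{Tr}\big(MBX^\dagger(MBX^\dagger)^H(XX^\dagger)^*\big)},$$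 the trace being real. **(b) Spectral norm.** $\sigma^{\mathbb S}(X,B)=\|BX^\dagger\|_2=\sigma^{\mathrm{unstruc}}(X,B)$. Let $r=\mathrm{rank}(X)$, let $X=U\Sigma V^H$ be a singular value decomposition with singular values in nonincreasing order, $U=[U_1\ U_2]$ with $U_1\in\mathbb K^{n\times r}$, and put $Y=MBX^\dagger$, $\mu=\|BX^\dagger\|_2$. Below, $H^{1/2}$ is the positive semidefinite square root of a positive semidefinite matrix $H$, and $H^{-1/2}$ is the Moore–Penrose pseudoinverse of $H^{1/2}$; a contraction is an $(n-r)\times(n-r)$ matrix $Z$ with $\|Z\|_2\le1$. *Case I:* $M\mathbb S=\mathsf{sym}$ ($\varepsilon=1$) or $M\mathbb S=\mathsf{skew\text{-}sym}$ ($\varepsilon=-1$). Let $K=YU_1(\mu^2I-\varepsilon U_1^H\overline{Y}YU_1)^{-1/2}$. The matrices $A\in\mathbb S(X,B)$ with $\|A\|_2=\sigma^{\mathbb S}(X,B)$ are exactly $$M^{-1}\mathcal F_T^\varepsilon(X,MB)-M^{-1}(I-XX^\dagger)^TKU_1^H\overline{YU_1}K^T(I-XX^\dagger)+M^{-1}f(Z),$$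 $$f(Z)=\mu\overline U_2(I-U_2^TKK^H\overline U_2)^{1/2}Z(I-U_2^H\overline KK^TU_2)^{1/2}U_2^H,$$ where $Z$ is an arbitrary contraction with $Z^T=\varepsilon Z$. *Case II:* $M\mathbb S=\mathsf{Herm}$. Let $K=YU_1(\mu^2I-U_1^HYYU_1)^{-1/2}$. The matrices $A\in\mathbb S(X,B)$ with $\|A\|_2=\sigma^{\mathbb S}(X,B)$ are exactly $$\mathcal G_Z(X,B)=M^{-1}\mathcal F_H^{1}(X,MB)-M^{-1}(I-XX^\dagger)KU_1^HYU_1K^H(I-XX^\dagger)+M^{-1}f(Z),$$ $$f(Z)=\mu U_2(I-U_2^HKK^HU_2)^{1/2}Z(I-U_2^HKK^HU_2)^{1/2}U_2^H,$$ where $Z$ is an arbitrary contraction with $Z^H=Z$. *Case III:* $M\mathbb S=\mathsf{skew\text{-}Herm}$, $\mathbb K=\mathbb C$. The matrices $A\in\mathbb S(X,B)$ with $\|A\|_2=\sigma^{\mathbb S}(X,B)$ are exactly the matrices $-iG$, where $G$ is a matrix of smallest spectral norm among those with $MG$ Hermitian and $GX=iB$; equivalently, exactly the matrices $-i\,\mathcal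 G_Z(X,iB)$, where $\mathcal G_Z(X,iB)$ is given by the formulas of Case II with $B$ replaced by $iB$, and $Z$ is an arbitrary contraction with $Z^H=Z$. -/

import Mathlib

open Matrix

noncomputable section

namespace StructuredMapping

variable {𝕜 : Type*} [RCLike 𝕜]
variable {m n p : Type*} [Fintype m] [Fintype n] [Fintype p]

/-! ### Norms -/

open scoped Matrix.Norms.L2Operator in
/-- The spectral norm `‖A‖₂`: the operator norm with respect to the Euclidean norms. -/
def spectralNorm [DecidableEq n] (A : Matrix m n 𝕜) : ℝ := ‖A‖

open scoped Matrix.Norms.Frobenius in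
/-- The Frobenius norm `‖A‖_F`. -/
def frobeniusNorm (A : Matrix m n 𝕜) : ℝ := ‖A‖

/-! ### Moore-Penrose pseudoinverse and square roots -/

/-- The four Penrose equations: `Y` is the Moore-Penrose pseudoinverse of `X`. -/
structure IsMoorePenrose (X : Matrix m n 𝕜) (Y : Matrix n m 𝕜) : Prop where
  mul_mul_self : X * Y * X = X
  self_mul_mul : Y * X * Y = Y
  left_herm : (X * Y)ᴴ = X * Y
  right_herm : (Y * X)ᴴ = Y * X

open scoped ComplexOrder in
theorem exists_isMoorePenrose [DecidableEq n] (X : Matrix m n 𝕜) :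
    ∃ Y : Matrix n m 𝕜, IsMoorePenrose X Y := by
  have hG : IsSelfAdjoint (Xᴴ * X) := isHermitian_conjTranspose_mul_self X
  have hfin : (spectrum ℝ (Xᴴ * X)).Finite :=
    Matrix.finite_real_spectrum
  have hc : ∀ f : ℝ → ℝ, ContinuousOn f (spectrum ℝ (Xᴴ * X)) := fun f => hfin.continuousOn f
  obtain ⟨D, hD⟩ : ∃ D, D = cfc (fun t : ℝ => t⁻¹) (Xᴴ * X) := ⟨_, rfl⟩
  have hDs : Dᴴ = D := by
    rw [hD]; exact cfc_predicate (fun t : ℝ => t⁻¹) (Xᴴ * X)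
  have hid : cfc (fun t : ℝ => t) (Xᴴ * X) = Xᴴ * X := cfc_id' ℝ (Xᴴ * X)
  have h1 : D * (Xᴴ * X) = cfc (fun t : ℝ => t⁻¹ * t) (Xᴴ * X) := by
    rw [cfc_mul _ _ _ (hc _) (hc _), hid, hD]
  have h2 : (D * (Xᴴ * X))ᴴ = D * (Xᴴ * X) := by
    rw [h1]; exact cfc_predicate (fun t : ℝ => t⁻¹ * t) (Xᴴ * X)
  have h3 : D * (Xᴴ * X) * D = D := by
    rw [h1, hD, ← cfc_mul _ _ _ (hc _) (hc _)]
    congr 1; ext t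
    by_cases ht : t = 0
    · simp [ht]
    · field_simp
  have h4 : (Xᴴ * X) * (D * (Xᴴ * X)) = Xᴴ * X := by
    conv_lhs => rw [h1]
    conv_lhs => enter [1]; rw [← hid]
    rw [← cfc_mul _ _ _ (hc _) (hc _)]
    conv_rhs => rw [← hid]
    congr 1; ext t
    by_cases ht : t = 0
    · simp [ht]
    · field_simp
  have h5 : X * (D * (Xᴴ * X)) - X = 0 := by
    rw [← conjTranspose_mul_self_eq_zero]
    have : (X * (D * (Xᴴ * X)) - X)ᴴ * (X * (D * (Xᴴ * X)) - X)
        = (D * (Xᴴ * X)) * ((Xᴴ * X) * (D * (Xᴴ * X)) - Xᴴ * X)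
          - ((Xᴴ * X) * (D * (Xᴴ * X)) - Xᴴ * X) := by
      rw [conjTranspose_sub, conjTranspose_mul, h2]
      simp only [Matrix.mul_sub, Matrix.sub_mul, Matrix.mul_assoc]
      abel
    rw [this, h4]; simp
  refine ⟨D * Xᴴ, ?_, ?_, ?_, ?_⟩
  · simpa [Matrix.mul_assoc] using sub_eq_zero.mp h5
  · calc D * Xᴴ * X * (D * Xᴴ) = D * (Xᴴ * X) * D * Xᴴ := by simp only [Matrix.mul_assoc]
      _ = D * Xᴴ := by rw [h3]
  · simp [conjTranspose_mul, hDs, Matrix.mul_assoc]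
  · simpa [Matrix.mul_assoc] using h2

/-- The Moore-Penrose pseudoinverse `X†`. -/
def pinv [DecidableEq n] (X : Matrix m n 𝕜) : Matrix n m 𝕜 :=
  Classical.choose (exists_isMoorePenrose X)

/-- The positive semidefinite square root `H^{1/2}` of a positive semidefinite matrix. -/
def psdSqrt [DecidableEq n] (H : Matrix n n 𝕜) : Matrix n n 𝕜 := cfc Real.sqrt H

/-- `H^{-1/2}` for a positive semidefinite matrix `H`, the inverse being the Moore-Penrose
pseudoinverse when `H` is singular. -/
def psdInvSqrt [DecidableEq n] (H : Matrix n n 𝕜) : Matrix n n 𝕜 := pinv (psdSqrt H)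

/-- The entrywise complex conjugate of a matrix. -/
def conjMat (A : Matrix m n 𝕜) : Matrix m n 𝕜 := A.map (starRingEnd 𝕜)

/-! ### Scalar products, Jordan and Lie algebras -/

/-- The kind of a scalar product: bilinear `⟨x, y⟩ = yᵀ M x` or sesquilinear `⟨x, y⟩ = yᴴ M x`. -/
inductive FormKind
  | bilinear
  | sesquilinear

/-- `A^*`: the transpose for a bilinear, the conjugate transpose for a sesquilinear form. -/
def FormKind.tr (k : FormKind) (A : Matrix m n 𝕜) : Matrix n m 𝕜 :=
  match k with
  | .bilinear => Aᵀ
  | .sesquilinear => Aᴴ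

/-- The scalar product `⟨x, y⟩_M`. -/
def scalarProd (k : FormKind) (M : Matrix n n 𝕜) (x y : n → 𝕜) : 𝕜 :=
  match k with
  | .bilinear => y ⬝ᵥ (M *ᵥ x)
  | .sesquilinear => star y ⬝ᵥ (M *ᵥ x)

/-- The adjoint `A^⋆ = M⁻¹ A^* M` with respect to `⟨·, ·⟩_M`. -/
def adj [DecidableEq n] (k : FormKind) (M A : Matrix n n 𝕜) : Matrix n n 𝕜 :=
  M⁻¹ * k.tr A * M

/-- `adj k M A` is the adjoint of `A` with respect to the scalar product given by `M`. -/
theorem scalarProd_adj [DecidableEq n] (k : FormKind) (M A : Matrix n n 𝕜)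
    (hU : M ∈ Matrix.unitaryGroup n 𝕜) (hM : k.tr M = M ∨ k.tr M = -M) (x y : n → 𝕜) :
    scalarProd k M (A *ᵥ x) y = scalarProd k M x (adj k M A *ᵥ y) := by
  have hdet : IsUnit M.det := by
    have h := Matrix.mem_unitaryGroup_iff.mp hU
    have h' := congrArg Matrix.det h
    rw [det_mul, det_one] at h'
    exact IsUnit.of_mul_eq_one _ h'
  have key : k.tr (adj k M A) * M = M * A := by
    have hinv' : M⁻¹ * M = 1 := Matrix.nonsing_inv_mul M hdet
    have hneg : (-M)⁻¹ = -M⁻¹ := Matrix.inv_eq_left_inv (by rw [neg_mul_neg, hinv'])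
    cases k
    · simp only [FormKind.tr, adj, transpose_mul, transpose_transpose,
        transpose_nonsing_inv] at hM ⊢
      rcases hM with h | h
      · rw [h, Matrix.mul_assoc, Matrix.mul_assoc, hinv', Matrix.mul_one]
      · rw [h, hneg]
        simp [Matrix.mul_assoc, hinv']
    · simp only [FormKind.tr, adj, conjTranspose_mul, conjTranspose_conjTranspose,
        conjTranspose_nonsing_inv] at hM ⊢
      rcases hM with h | h
      · rw [h, Matrix.mul_assoc, Matrix.mul_assoc, hinv', Matrix.mul_one]
      · rw [h, hneg]
        simp [Matrix.mul_assoc, hinv']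
  cases k
  · simp only [scalarProd, FormKind.tr] at key ⊢
    rw [mulVec_mulVec, ← key, ← mulVec_mulVec, dotProduct_mulVec, vecMul_transpose]
  · simp only [scalarProd, FormKind.tr] at key ⊢
    rw [mulVec_mulVec, ← key, ← mulVec_mulVec, dotProduct_mulVec, vecMul_conjTranspose, star_star]

/-- Which of the two algebras attached to a scalar product is meant. -/
inductive AlgebraKind
  | jordan
  | lie

/-- The Jordan algebra `{A | A^⋆ = A}` or the Lie algebra `{A | A^⋆ = -A}` of `⟨·, ·⟩_M`. -/
def structuredSet [DecidableEq n] (k : FormKind) (M : Matrix n n 𝕜) (a : AlgebraKind) :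
    Set (Matrix n n 𝕜) :=
  match a with
  | .jordan => {A | adj k M A = A}
  | .lie => {A | adj k M A = -A}

/-- `M S = {M A | A ∈ S}`. -/
def leftMul (M : Matrix n n 𝕜) (S : Set (Matrix n n 𝕜)) : Set (Matrix n n 𝕜) :=
  (fun A => M * A) '' S

/-- The four prototype classes of structured matrices. -/
inductive MatrixClass
  | sym
  | skewSym
  | herm
  | skewHerm

namespace MatrixClass

/-- The set of matrices of the class. -/
def carrier (c : MatrixClass) (n : Type*) (𝕜 : Type*) [RCLike 𝕜] : Set (Matrix n n 𝕜) :=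
  match c with
  | sym => {A | Aᵀ = A}
  | skewSym => {A | Aᵀ = -A}
  | herm => {A | Aᴴ = A}
  | skewHerm => {A | Aᴴ = -A}

/-- Whether `^*` means transpose or conjugate transpose for the class. -/
def form : MatrixClass → FormKind
  | sym | skewSym => .bilinear
  | herm | skewHerm => .sesquilinear

/-- The sign `ε` in `A^* = ε A`. -/
def sign : MatrixClass → ℤ
  | sym | herm => 1
  | skewSym | skewHerm => -1

end MatrixClass

/-! ### The structured mapping problem -/

/-- `S(X, B) = {A ∈ S | A X = B}`. -/
def solutionSet (S : Set (Matrix n n 𝕜)) (X B : Matrix n p 𝕜) : Set (Matrix n n 𝕜) :=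
  {A | A ∈ S ∧ A * X = B}

/-- `σ^S(X, B) = inf {‖A‖ | A ∈ S(X, B)}` for the norm `N`. -/
def minNorm (N : Matrix n n 𝕜 → ℝ) (S : Set (Matrix n n 𝕜)) (X B : Matrix n p 𝕜) : ℝ :=
  sInf (N '' solutionSet S X B)

/-- `A` is an optimal solution: `A ∈ S(X, B)` and `‖A‖ = σ^S(X, B)`. -/
def IsOptimal (N : Matrix n n 𝕜 → ℝ) (S : Set (Matrix n n 𝕜)) (X B : Matrix n p 𝕜)
    (A : Matrix n n 𝕜) : Prop :=
  A ∈ solutionSet S X B ∧ N A = minNorm N S X B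

/-- `F_*(X, B) = B X† + ε (B X†)^* - (X†)^* (X^* B) X†`, where `ε = 1` or `ε = -1` according to
whether `X^* B` is to be (conjugate-)symmetric or (conjugate-)skew-symmetric. -/
def solMap [DecidableEq p] (k : FormKind) (ε : ℤ) (X B : Matrix n p 𝕜) : Matrix n n 𝕜 :=
  B * pinv X + ε • k.tr (B * pinv X) - k.tr (pinv X) * (k.tr X * B) * pinv X

/-! ### Singular value decomposition and the optimal families for the spectral norm -/

/-- `X = U Σ Vᴴ` is a singular value decomposition: `U`, `V` are unitary and `Σ` is rectangular
diagonal with nonnegative nonincreasing diagonal entries `s 0 ≥ s 1 ≥ ⋯`. -/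
structure IsSVD {n p : ℕ} (X : Matrix (Fin n) (Fin p) 𝕜) (U : Matrix (Fin n) (Fin n) 𝕜)
    (s : ℕ → ℝ) (V : Matrix (Fin p) (Fin p) 𝕜) : Prop where
  unitary_left : U ∈ Matrix.unitaryGroup (Fin n) 𝕜
  unitary_right : V ∈ Matrix.unitaryGroup (Fin p) 𝕜
  nonneg : ∀ i, 0 ≤ s i
  anti : Antitone s
  eq : X = U * (Matrix.of fun (i : Fin n) (j : Fin p) =>
    if (i : ℕ) = (j : ℕ) then ((s i : ℝ) : 𝕜) else 0) * Vᴴ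

/-- `U₁`: the first `r` columns of `U`. -/
def leftCols {n : ℕ} (U : Matrix (Fin n) (Fin n) 𝕜) (r : ℕ) :
    Matrix (Fin n) {i : Fin n // (i : ℕ) < r} 𝕜 :=
  U.submatrix id Subtype.val

/-- `U₂`: the remaining columns of `U`. -/
def rightCols {n : ℕ} (U : Matrix (Fin n) (Fin n) 𝕜) (r : ℕ) :
    Matrix (Fin n) {i : Fin n // r ≤ (i : ℕ)} 𝕜 :=
  U.submatrix id Subtype.val

/-- The matrix `A_o` attached to a contraction `Z` when `M S` is the class of symmetric (`ε = 1`)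
or skew-symmetric (`ε = -1`) matrices. -/
def familyT {n p : ℕ} (ε : ℤ) (M : Matrix (Fin n) (Fin n) 𝕜) (X B : Matrix (Fin n) (Fin p) 𝕜)
    (U : Matrix (Fin n) (Fin n) 𝕜)
    (Z : Matrix {i : Fin n // X.rank ≤ (i : ℕ)} {i : Fin n // X.rank ≤ (i : ℕ)} 𝕜) :
    Matrix (Fin n) (Fin n) 𝕜 :=
  let U₁ := leftCols U X.rank
  let U₂ := rightCols U X.rank
  let Y := M * B * pinv X
  let Q := 1 - X * pinv X
  let μ : 𝕜 := ((spectralNorm (B * pinv X) : ℝ) : 𝕜)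
  let K := Y * U₁ * psdInvSqrt (μ ^ 2 • 1 - ε • (U₁ᴴ * conjMat Y * Y * U₁))
  let fZ := μ • (conjMat U₂ * psdSqrt (1 - U₂ᵀ * K * Kᴴ * conjMat U₂) * Z *
    psdSqrt (1 - U₂ᴴ * conjMat K * Kᵀ * U₂) * U₂ᴴ)
  M⁻¹ * solMap .bilinear ε X (M * B)
    - M⁻¹ * Qᵀ * K * U₁ᴴ * conjMat (Y * U₁) * Kᵀ * Q + M⁻¹ * fZ

/-- The matrix `A_o` attached to a contraction `Z` when `M S` is the class of Hermitian
matrices. -/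
def familyH {n p : ℕ} (M : Matrix (Fin n) (Fin n) 𝕜) (X B : Matrix (Fin n) (Fin p) 𝕜)
    (U : Matrix (Fin n) (Fin n) 𝕜)
    (Z : Matrix {i : Fin n // X.rank ≤ (i : ℕ)} {i : Fin n // X.rank ≤ (i : ℕ)} 𝕜) :
    Matrix (Fin n) (Fin n) 𝕜 :=
  let U₁ := leftCols U X.rank
  let U₂ := rightCols U X.rank
  let Y := M * B * pinv X
  let Q := 1 - X * pinv X
  let μ : 𝕜 := ((spectralNorm (B * pinv X) : ℝ) : 𝕜)
  let K := Y * U₁ * psdInvSqrt (μ ^ 2 • 1 - U₁ᴴ * Y * Y * U₁)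
  let fZ := μ • (U₂ * psdSqrt (1 - U₂ᴴ * K * Kᴴ * U₂) * Z *
    psdSqrt (1 - U₂ᴴ * K * Kᴴ * U₂) * U₂ᴴ)
  M⁻¹ * solMap .sesquilinear 1 X (M * B)
    - M⁻¹ * Q * K * U₁ᴴ * Y * U₁ * Kᴴ * Q + M⁻¹ * fZ

end StructuredMapping

end

/-! Multiplication by the unitary matrix `M` preserves both norms and turns the problem into
`H X = N` with `H^* = ε H`. With respect to the orthogonal splitting into the range of `X` and its
complement, the first block column of `H` is prescribed by `N` and the first block row by symmetry,
so only the `(2, 2)` corner is free, subject to the same symmetry.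

For the Frobenius norm, Pythagoras makes the zero corner the unique optimum. For the spectral norm,
`‖[a b; c x]‖ ≤ μ` says that `[b; x] [b; x]ᴴ ≤ W Wᴴ`, where `W` is a triangular factor of
`μ² - [a; c] [a; c]ᴴ`. By Douglas' lemma `[b; x] = W N` with a contraction `N`, whose first block
is forced by `b` and whose second block supplies the contraction `Z` parametrizing the corner `x`.
When `x` satisfies `x^* = ε x`, averaging `Z` with `ε Z^*` gives a parameter with the same symmetry.
The skew-Hermitian class is reduced to the Hermitian one by multiplication by the imaginary unit. -/

noncomputable section

namespace StructuredMapping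

open scoped ComplexOrder MatrixOrder

variable {𝕜 : Type*} [RCLike 𝕜]
variable {l m n p : Type*} [Fintype l] [Fintype m] [Fintype n] [Fintype p]

/-! ### The Loewner order and the spectral norm -/

omit [Fintype m] in
theorem conjTranspose_mul_mul_le [Finite m] {A B : Matrix n n 𝕜} (h : A ≤ B)
    (C : Matrix n m 𝕜) : Cᴴ * A * C ≤ Cᴴ * B * C := by
  rw [Matrix.le_iff] at h ⊢
  simpa only [Matrix.mul_sub, Matrix.sub_mul] using h.conjTranspose_mul_mul_same C

omit [Fintype m] in
theorem mul_mul_conjTranspose_le [Finite m] {A B : Matrix n n 𝕜} (h : A ≤ B)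
    (C : Matrix m n 𝕜) : C * A * Cᴴ ≤ C * B * Cᴴ := by
  simpa only [conjTranspose_conjTranspose] using conjTranspose_mul_mul_le h Cᴴ

omit [Fintype m] in
theorem eq_zero_of_mul_conjTranspose_nonpos [Finite m] {C : Matrix m n 𝕜}
    (h : C * Cᴴ ≤ 0) : C = 0 :=
  self_mul_conjTranspose_eq_zero.1 (h.antisymm (posSemidef_self_mul_conjTranspose C).nonneg)

section

variable [DecidableEq n]

open scoped Matrix.Norms.L2Operator in
theorem spectralNorm_nonneg (A : Matrix m n 𝕜) : 0 ≤ spectralNorm A :=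
  norm_nonneg A

open scoped Matrix.Norms.L2Operator in
theorem spectralNorm_smul (t : 𝕜) (A : Matrix m n 𝕜) :
    spectralNorm (t • A) = ‖t‖ * spectralNorm A :=
  norm_smul t A

open scoped Matrix.Norms.L2Operator in
theorem spectralNorm_add_le (A B : Matrix m n 𝕜) :
    spectralNorm (A + B) ≤ spectralNorm A + spectralNorm B :=
  norm_add_le A B

open scoped Matrix.Norms.L2Operator in
theorem spectralNorm_mul_le [DecidableEq m] (A : Matrix l m 𝕜) (B : Matrix m n 𝕜) :
    spectralNorm (A * B) ≤ spectralNorm A * spectralNorm B :=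
  Matrix.l2_opNorm_mul A B

open scoped Matrix.Norms.L2Operator in
theorem spectralNorm_conjTranspose [DecidableEq m] (A : Matrix m n 𝕜) :
    spectralNorm Aᴴ = spectralNorm A :=
  Matrix.l2_opNorm_conjTranspose A

omit [DecidableEq n] in
theorem star_dotProduct_self_eq_norm_sq (v : n → 𝕜) :
    star v ⬝ᵥ v = ((‖WithLp.toLp 2 v‖ ^ 2 : ℝ) : 𝕜) := by
  rw [EuclideanSpace.norm_sq_eq]
  simp [dotProduct, RCLike.conj_mul]

open scoped Matrix.Norms.L2Operator in
theorem spectralNorm_le_iff_forall_mulVec {A : Matrix m n 𝕜} {μ : ℝ} (hμ : 0 ≤ μ) :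
    spectralNorm A ≤ μ ↔ ∀ v, star (A *ᵥ v) ⬝ᵥ (A *ᵥ v) ≤ (μ : 𝕜) ^ 2 * (star v ⬝ᵥ v) := by
  simp only [star_dotProduct_self_eq_norm_sq, ← RCLike.ofReal_pow, ← RCLike.ofReal_mul,
    RCLike.ofReal_le_ofReal, ← mul_pow]
  rw [spectralNorm, Matrix.l2_opNorm_def, ContinuousLinearMap.opNorm_le_iff hμ]
  exact ⟨fun h v => pow_le_pow_left₀ (norm_nonneg _) (h (WithLp.toLp 2 v)) 2,
    fun h x => le_of_sq_le_sq (h x.ofLp) (by positivity)⟩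

theorem spectralNorm_le_iff {A : Matrix m n 𝕜} {μ : ℝ} (hμ : 0 ≤ μ) :
    spectralNorm A ≤ μ ↔ Aᴴ * A ≤ (μ : 𝕜) ^ 2 • 1 := by
  rw [spectralNorm_le_iff_forall_mulVec hμ, Matrix.le_iff, posSemidef_iff_dotProduct_mulVec]
  have hherm : ((μ : 𝕜) ^ 2 • 1 - Aᴴ * A).IsHermitian := by
    simp [IsHermitian, conjTranspose_smul]
  simp only [hherm, true_and, sub_mulVec, dotProduct_sub, sub_nonneg, smul_mulVec, one_mulVec,
    dotProduct_smul, smul_eq_mul, star_mulVec, dotProduct_mulVec, vecMul_vecMul]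

theorem spectralNorm_le_iff' [DecidableEq m] {A : Matrix m n 𝕜} {μ : ℝ} (hμ : 0 ≤ μ) :
    spectralNorm A ≤ μ ↔ A * Aᴴ ≤ (μ : 𝕜) ^ 2 • 1 := by
  rw [← spectralNorm_conjTranspose, spectralNorm_le_iff hμ, conjTranspose_conjTranspose]

theorem spectralNorm_le_one_iff {A : Matrix m n 𝕜} : spectralNorm A ≤ 1 ↔ Aᴴ * A ≤ 1 := by
  simpa using spectralNorm_le_iff (A := A) zero_le_one

theorem spectralNorm_le_one_iff' [DecidableEq m] {A : Matrix m n 𝕜} :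
    spectralNorm A ≤ 1 ↔ A * Aᴴ ≤ 1 := by
  simpa using spectralNorm_le_iff' (A := A) zero_le_one

theorem spectralNorm_transpose_le [DecidableEq m] (A : Matrix m n 𝕜) :
    spectralNorm Aᵀ ≤ spectralNorm A := by
  have h := (spectralNorm_le_iff' (spectralNorm_nonneg A)).1 le_rfl
  rw [spectralNorm_le_iff (spectralNorm_nonneg A)]
  simpa [Matrix.le_iff, transpose_mul, conjTranspose, transpose_map] using
    (Matrix.le_iff.1 h).transpose

theorem spectralNorm_transpose [DecidableEq m] (A : Matrix m n 𝕜) :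
    spectralNorm Aᵀ = spectralNorm A :=
  (spectralNorm_transpose_le A).antisymm (spectralNorm_transpose_le Aᵀ)

theorem spectralNorm_isometry_mul [DecidableEq m] {V : Matrix l m 𝕜} (hV : Vᴴ * V = 1)
    (A : Matrix m n 𝕜) : spectralNorm (V * A) = spectralNorm A := by
  have hgram : (V * A)ᴴ * (V * A) = Aᴴ * A := by
    rw [conjTranspose_mul, Matrix.mul_assoc, ← Matrix.mul_assoc Vᴴ, hV, Matrix.one_mul]
  have hle : ∀ μ : ℝ, 0 ≤ μ → (spectralNorm (V * A) ≤ μ ↔ spectralNorm A ≤ μ) := fun μ hμ => by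
    rw [spectralNorm_le_iff hμ, spectralNorm_le_iff hμ, hgram]
  exact ((hle _ (spectralNorm_nonneg A)).2 le_rfl).antisymm
    ((hle _ (spectralNorm_nonneg _)).1 le_rfl)

theorem spectralNorm_mul_coisometry [DecidableEq m] {V : Matrix m n 𝕜}
    (hV : V * Vᴴ = 1) (A : Matrix l m 𝕜) : spectralNorm (A * V) = spectralNorm A := by
  classical
  rw [← spectralNorm_conjTranspose, conjTranspose_mul,
    spectralNorm_isometry_mul (by rwa [conjTranspose_conjTranspose]), spectralNorm_conjTranspose]

theorem spectralNorm_le_one_of_isStarProjection {P : Matrix n n 𝕜} (hP : IsStarProjection P) :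
    spectralNorm P ≤ 1 := by
  rw [spectralNorm_le_one_iff, ← star_eq_conjTranspose, hP.isSelfAdjoint.star_eq,
    hP.isIdempotentElem.eq]
  exact hP.le_one

end

/-! ### Moore-Penrose pseudoinverses -/

section

variable [DecidableEq n]

theorem pinv_spec (X : Matrix m n 𝕜) : IsMoorePenrose X (pinv X) :=
  Classical.choose_spec (exists_isMoorePenrose X)

namespace IsMoorePenrose

omit [DecidableEq n] in
theorem unique {X : Matrix m n 𝕜} {Y Z : Matrix n m 𝕜} (hY : IsMoorePenrose X Y)
    (hZ : IsMoorePenrose X Z) : Y = Z := by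
  have hleft : X * Y = X * Z := calc
    X * Y = (X * Z) * (X * Y) := by rw [← Matrix.mul_assoc, hZ.mul_mul_self]
    _ = ((X * Y) * (X * Z))ᴴ := by rw [conjTranspose_mul, hY.left_herm, hZ.left_herm]
    _ = X * Z := by rw [← Matrix.mul_assoc, hY.mul_mul_self, hZ.left_herm]
  have hright : Y * X = Z * X := calc
    Y * X = (Y * X) * (Z * X) := by
      rw [Matrix.mul_assoc, ← Matrix.mul_assoc X, hZ.mul_mul_self]
    _ = ((Z * X) * (Y * X))ᴴ := by rw [conjTranspose_mul, hY.right_herm, hZ.right_herm]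
    _ = Z * X := by rw [Matrix.mul_assoc, ← Matrix.mul_assoc X, hY.mul_mul_self, hZ.right_herm]
  rw [← hY.self_mul_mul, hright, Matrix.mul_assoc, hleft, ← Matrix.mul_assoc, hZ.self_mul_mul]

omit [DecidableEq n] in
theorem conjTranspose {X : Matrix m n 𝕜} {Y : Matrix n m 𝕜} (h : IsMoorePenrose X Y) :
    IsMoorePenrose Xᴴ Yᴴ where
  mul_mul_self := by rw [← conjTranspose_mul, ← conjTranspose_mul, ← Matrix.mul_assoc,
    h.mul_mul_self]
  self_mul_mul := by rw [← conjTranspose_mul, ← conjTranspose_mul, ← Matrix.mul_assoc,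
    h.self_mul_mul]
  left_herm := by rw [← conjTranspose_mul, h.right_herm, h.right_herm]
  right_herm := by rw [← conjTranspose_mul, h.left_herm, h.left_herm]

omit [DecidableEq n] in
theorem transpose {X : Matrix m n 𝕜} {Y : Matrix n m 𝕜} (h : IsMoorePenrose X Y) :
    IsMoorePenrose Xᵀ Yᵀ where
  mul_mul_self := by rw [← transpose_mul, ← transpose_mul, ← Matrix.mul_assoc, h.mul_mul_self]
  self_mul_mul := by rw [← transpose_mul, ← transpose_mul, ← Matrix.mul_assoc, h.self_mul_mul]
  left_herm := by rw [← transpose_mul]; exact congrArg Matrix.transpose h.right_herm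
  right_herm := by rw [← transpose_mul]; exact congrArg Matrix.transpose h.left_herm

omit [DecidableEq n] in
theorem isStarProjection {X : Matrix m n 𝕜} {Y : Matrix n m 𝕜} (h : IsMoorePenrose X Y) :
    IsStarProjection (X * Y) where
  isIdempotentElem := by rw [IsIdempotentElem, ← Matrix.mul_assoc, h.mul_mul_self]
  isSelfAdjoint := h.left_herm

omit [DecidableEq n] in
theorem isStarProjection' {X : Matrix m n 𝕜} {Y : Matrix n m 𝕜} (h : IsMoorePenrose X Y) :
    IsStarProjection (Y * X) where
  isIdempotentElem := by rw [IsIdempotentElem, ← Matrix.mul_assoc, h.self_mul_mul]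
  isSelfAdjoint := h.right_herm

end IsMoorePenrose

theorem mul_pinv_mul_self (X : Matrix m n 𝕜) : X * pinv X * X = X :=
  (pinv_spec X).mul_mul_self

theorem pinv_mul_mul_pinv (X : Matrix m n 𝕜) : pinv X * X * pinv X = pinv X :=
  (pinv_spec X).self_mul_mul

theorem pinv_conjTranspose [DecidableEq m] (X : Matrix m n 𝕜) : pinv Xᴴ = (pinv X)ᴴ :=
  (pinv_spec Xᴴ).unique (pinv_spec X).conjTranspose

theorem pinv_transpose [DecidableEq m] (X : Matrix m n 𝕜) : pinv Xᵀ = (pinv X)ᵀ :=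
  (pinv_spec Xᵀ).unique (pinv_spec X).transpose

theorem isStarProjection_mul_pinv (X : Matrix m n 𝕜) : IsStarProjection (X * pinv X) :=
  (pinv_spec X).isStarProjection

theorem one_sub_mul_pinv_mul [DecidableEq m] (X : Matrix m n 𝕜) :
    (1 - X * pinv X) * X = 0 := by
  rw [Matrix.sub_mul, Matrix.one_mul, mul_pinv_mul_self, sub_self]

theorem pinv_mul_eq_mul_pinv_of_conjTranspose {E : Matrix n n 𝕜} (hE : Eᴴ = E) :
    pinv E * E = E * pinv E := by
  have hpinv : (pinv E)ᴴ = pinv E := by rw [← pinv_conjTranspose, hE]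
  rw [← (pinv_spec E).right_herm, conjTranspose_mul, hE, hpinv]

end

/-! ### Factorization through a dominating Gram matrix -/

section

variable [DecidableEq n]

theorem mul_pinv_mul_of_gram_le {W : Matrix m n 𝕜} {B : Matrix m l 𝕜}
    (h : B * Bᴴ ≤ W * Wᴴ) : W * (pinv W * B) = B := by
  classical
  have hQB : (1 - W * pinv W) * B = 0 := by
    refine eq_zero_of_mul_conjTranspose_nonpos ?_
    have := mul_mul_conjTranspose_le h (1 - W * pinv W)
    rwa [← Matrix.mul_assoc _ W, one_sub_mul_pinv_mul, Matrix.zero_mul, Matrix.zero_mul,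
      ← Matrix.mul_assoc, Matrix.mul_assoc, ← conjTranspose_mul] at this
  rwa [Matrix.sub_mul, Matrix.one_mul, sub_eq_zero, eq_comm, Matrix.mul_assoc] at hQB

theorem spectralNorm_pinv_mul_le_one [DecidableEq l] {W : Matrix m n 𝕜} {B : Matrix m l 𝕜}
    (h : B * Bᴴ ≤ W * Wᴴ) : spectralNorm (pinv W * B) ≤ 1 := by
  rw [spectralNorm_le_one_iff']
  calc pinv W * B * (pinv W * B)ᴴ = pinv W * (B * Bᴴ) * (pinv W)ᴴ := by
        simp only [conjTranspose_mul, Matrix.mul_assoc]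
    _ ≤ pinv W * (W * Wᴴ) * (pinv W)ᴴ := mul_mul_conjTranspose_le h _
    _ = pinv W * W * (pinv W * W)ᴴ := by simp only [conjTranspose_mul, Matrix.mul_assoc]
    _ = pinv W * W := by
        rw [(pinv_spec W).right_herm, (pinv_spec W).isStarProjection'.isIdempotentElem.eq]
    _ ≤ 1 := (pinv_spec W).isStarProjection'.le_one

theorem mul_pinv_mul_of_gram_le' {W : Matrix m n 𝕜} {B : Matrix l n 𝕜}
    (h : Bᴴ * B ≤ Wᴴ * W) : B * pinv W * W = B := by
  classical
  have := mul_pinv_mul_of_gram_le (W := Wᴴ) (B := Bᴴ) (by simpa using h)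
  simpa only [pinv_conjTranspose, ← conjTranspose_mul, conjTranspose_inj] using this

theorem spectralNorm_mul_pinv_le_one [DecidableEq m] {W : Matrix m n 𝕜} {B : Matrix l n 𝕜}
    (h : Bᴴ * B ≤ Wᴴ * W) : spectralNorm (B * pinv W) ≤ 1 := by
  classical
  have := spectralNorm_pinv_mul_le_one (W := Wᴴ) (B := Bᴴ) (by simpa using h)
  rwa [pinv_conjTranspose, ← conjTranspose_mul, spectralNorm_conjTranspose] at this

omit [DecidableEq n] [Fintype m] in
theorem gram_mul_le [Finite m] [DecidableEq l] {W : Matrix m n 𝕜} {N : Matrix n l 𝕜}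
    (hN : spectralNorm N ≤ 1) : W * N * (W * N)ᴴ ≤ W * Wᴴ := by
  classical
  simpa only [Matrix.mul_assoc, conjTranspose_mul, Matrix.one_mul] using
    mul_mul_conjTranspose_le (spectralNorm_le_one_iff'.1 hN) W

end

/-! ### Square roots and defects -/

section

variable [DecidableEq m] [DecidableEq n]

theorem exists_aeval_eq_cfc (f : ℝ → ℝ) {P : Matrix m m 𝕜} {Q : Matrix n n 𝕜} (hP : Pᴴ = P)
    (hQ : Qᴴ = Q) :
    ∃ q : Polynomial ℝ, cfc f P = Polynomial.aeval P q ∧ cfc f Q = Polynomial.aeval Q q := by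
  have hfin : (spectrum ℝ P ∪ spectrum ℝ Q).Finite :=
    Matrix.finite_real_spectrum.union Matrix.finite_real_spectrum
  let q := Lagrange.interpolate hfin.toFinset id f
  have hq : ∀ x ∈ spectrum ℝ P ∪ spectrum ℝ Q, f x = q.eval x := fun x hx =>
    (Lagrange.eval_interpolate_at_node (v := id) f (Set.injOn_id _) (hfin.mem_toFinset.2 hx)).symm
  refine ⟨q, ?_, ?_⟩
  · rw [← cfc_polynomial q P (show IsSelfAdjoint P from hP)]
    exact cfc_congr fun x hx => hq x (Or.inl hx)
  · rw [← cfc_polynomial q Q (show IsSelfAdjoint Q from hQ)]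
    exact cfc_congr fun x hx => hq x (Or.inr hx)

theorem mul_aeval_eq_aeval_mul {P : Matrix m m 𝕜} {Q : Matrix n n 𝕜} {A : Matrix n m 𝕜}
    (h : A * P = Q * A) (q : Polynomial ℝ) :
    A * Polynomial.aeval P q = Polynomial.aeval Q q * A := by
  induction q using Polynomial.induction_on' with
  | add f g hf hg => simp only [map_add, Matrix.mul_add, Matrix.add_mul, hf, hg]
  | monomial k t =>
    have hpow : A * P ^ k = Q ^ k * A := by
      induction k with
      | zero => simp
      | succ k ih => rw [pow_succ, ← Matrix.mul_assoc, ih, Matrix.mul_assoc, h, pow_succ,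
          Matrix.mul_assoc]
    simp [Polynomial.aeval_monomial, ← Algebra.smul_def, hpow]

theorem mul_cfc_eq_cfc_mul (f : ℝ → ℝ) {P : Matrix m m 𝕜} {Q : Matrix n n 𝕜} {A : Matrix n m 𝕜}
    (hP : Pᴴ = P) (hQ : Qᴴ = Q) (h : A * P = Q * A) : A * cfc f P = cfc f Q * A := by
  obtain ⟨q, hqP, hqQ⟩ := exists_aeval_eq_cfc f hP hQ
  rw [hqP, hqQ, mul_aeval_eq_aeval_mul h]

theorem cfc_transpose (f : ℝ → ℝ) {P : Matrix n n 𝕜} (hP : Pᴴ = P) :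
    cfc f Pᵀ = (cfc f P)ᵀ := by
  obtain ⟨q, hqP, hqPt⟩ := exists_aeval_eq_cfc f hP (Q := Pᵀ) (congrArg transpose hP)
  rw [hqP, hqPt]
  clear hqP hqPt
  induction q using Polynomial.induction_on' with
  | add f g hf hg => simp only [map_add, transpose_add, hf, hg]
  | monomial k t => simp [Polynomial.aeval_monomial, ← Algebra.smul_def, transpose_pow]

theorem psdSqrt_conjTranspose (P : Matrix n n 𝕜) : (psdSqrt P)ᴴ = psdSqrt P :=
  cfc_predicate (R := ℝ) (p := IsSelfAdjoint) Real.sqrt P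

theorem psdSqrt_mul_self {P : Matrix n n 𝕜} (hP : 0 ≤ P) : psdSqrt P * psdSqrt P = P := by
  have hfin : (spectrum ℝ P).Finite := Matrix.finite_real_spectrum
  rw [psdSqrt, ← cfc_mul _ _ _ (hfin.continuousOn _) (hfin.continuousOn _)]
  conv_rhs => rw [← cfc_id' ℝ P hP.posSemidef.isHermitian]
  exact cfc_congr fun x hx => Real.mul_self_sqrt (spectrum_nonneg_of_nonneg hP hx)

end

section

variable [DecidableEq n]

/-- The defect operator `(μ² - AᴴA)^{1/2}` of a matrix `A` with `‖A‖₂ ≤ μ`. -/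
def defect (μ : ℝ) (A : Matrix m n 𝕜) : Matrix n n 𝕜 :=
  psdSqrt ((μ : 𝕜) ^ 2 • 1 - Aᴴ * A)

theorem defect_conjTranspose (μ : ℝ) (A : Matrix m n 𝕜) : (defect μ A)ᴴ = defect μ A :=
  psdSqrt_conjTranspose _

theorem defect_mul_self {μ : ℝ} (hμ : 0 ≤ μ) {A : Matrix m n 𝕜} (hA : spectralNorm A ≤ μ) :
    defect μ A * defect μ A = (μ : 𝕜) ^ 2 • 1 - Aᴴ * A :=
  psdSqrt_mul_self (sub_nonneg.2 ((spectralNorm_le_iff hμ).1 hA))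

omit [Fintype n] in
theorem conjTranspose_smul_one_sub_gram (μ : ℝ) (A : Matrix m n 𝕜) :
    ((μ : 𝕜) ^ 2 • 1 - Aᴴ * A)ᴴ = (μ : 𝕜) ^ 2 • 1 - Aᴴ * A := by
  simp [conjTranspose_smul]

theorem mul_defect [DecidableEq m] (μ : ℝ) (A : Matrix m n 𝕜) :
    A * defect μ A = defect μ Aᴴ * A :=
  mul_cfc_eq_cfc_mul Real.sqrt (conjTranspose_smul_one_sub_gram μ A)
    (conjTranspose_smul_one_sub_gram μ Aᴴ) (by
      simp only [conjTranspose_conjTranspose, Matrix.mul_sub, Matrix.sub_mul, Matrix.mul_smul,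
        Matrix.smul_mul, Matrix.mul_one, Matrix.one_mul, Matrix.mul_assoc])

end

/-! ### The Davis-Kahan-Weinberger theorem -/

section

variable {m₁ m₂ n₁ n₂ : Type*} [Fintype m₁] [Fintype m₂] [Fintype n₁] {μ : ℝ}

theorem spectralNorm_fromRows_le_iff [DecidableEq n₁] (hμ : 0 ≤ μ) {A : Matrix m₁ n₁ 𝕜}
    {C : Matrix m₂ n₁ 𝕜} :
    spectralNorm (fromRows A C) ≤ μ ↔ Aᴴ * A + Cᴴ * C ≤ (μ : 𝕜) ^ 2 • 1 := by
  rw [spectralNorm_le_iff hμ, conjTranspose_fromRows_eq_fromCols_conjTranspose,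
    fromCols_mul_fromRows]

theorem gram_le_gram_defect [DecidableEq n₁] {a : Matrix m₁ n₁ 𝕜} {c : Matrix m₂ n₁ 𝕜}
    (hμ : 0 ≤ μ) (ha : spectralNorm a ≤ μ) (hcol : spectralNorm (fromRows a c) ≤ μ) :
    cᴴ * c ≤ (defect μ a)ᴴ * defect μ a := by
  rw [defect_conjTranspose, defect_mul_self hμ ha, le_sub_iff_add_le']
  exact (spectralNorm_fromRows_le_iff hμ).1 hcol

section

variable [Fintype n₂] [DecidableEq m₁] [DecidableEq n₁] [DecidableEq n₂]

theorem spectralNorm_fromCols_le_iff (hμ : 0 ≤ μ) {A : Matrix m₁ n₁ 𝕜} {B : Matrix m₁ n₂ 𝕜} :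
    spectralNorm (fromCols A B) ≤ μ ↔ A * Aᴴ + B * Bᴴ ≤ (μ : 𝕜) ^ 2 • 1 := by
  rw [spectralNorm_le_iff' hμ, conjTranspose_fromCols_eq_fromRows_conjTranspose,
    fromCols_mul_fromRows]

omit [DecidableEq m₁] in
theorem spectralNorm_left_le_of_fromCols_le (hμ : 0 ≤ μ) {A : Matrix m₁ n₁ 𝕜}
    {B : Matrix m₁ n₂ 𝕜} (h : spectralNorm (fromCols A B) ≤ μ) : spectralNorm A ≤ μ := by
  classical
  exact (spectralNorm_le_iff' hμ).2 <|
    (le_add_of_nonneg_right (posSemidef_self_mul_conjTranspose B).nonneg).trans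
      ((spectralNorm_fromCols_le_iff hμ).1 h)

theorem gram_le_gram_defect' {a : Matrix m₁ n₁ 𝕜} {b : Matrix m₁ n₂ 𝕜} (hμ : 0 ≤ μ)
    (ha : spectralNorm a ≤ μ) (hrow : spectralNorm (fromCols a b) ≤ μ) :
    b * bᴴ ≤ defect μ aᴴ * (defect μ aᴴ)ᴴ := by
  rw [defect_conjTranspose, defect_mul_self hμ (by rwa [spectralNorm_conjTranspose]),
    conjTranspose_conjTranspose, le_sub_iff_add_le']
  exact (spectralNorm_fromCols_le_iff hμ).1 hrow

end

variable [DecidableEq m₁] [DecidableEq m₂]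

/-- The lower triangular factor of `μ² - [a; c] [a; c]ᴴ`, where `c = K (μ² - aᴴa)^{1/2}`. -/
def columnFactor (μ : ℝ) (a : Matrix m₁ n₁ 𝕜) (K : Matrix m₂ n₁ 𝕜) :
    Matrix (m₁ ⊕ m₂) (m₁ ⊕ m₂) 𝕜 :=
  fromBlocks (defect μ aᴴ) 0 (-(K * aᴴ)) ((μ : 𝕜) • defect 1 Kᴴ)

theorem columnFactor_conjTranspose (μ : ℝ) (a : Matrix m₁ n₁ 𝕜) (K : Matrix m₂ n₁ 𝕜) :
    (columnFactor μ a K)ᴴ =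
      fromBlocks (defect μ aᴴ) (-(a * Kᴴ)) 0 ((μ : 𝕜) • defect 1 Kᴴ) := by
  simp [columnFactor, fromBlocks_conjTranspose, defect_conjTranspose, conjTranspose_smul]

theorem columnFactor_mul_fromRows {a : Matrix m₁ n₁ 𝕜} {K : Matrix m₂ n₁ 𝕜}
    {N₁ : Matrix m₁ n₂ 𝕜} {N₂ : Matrix m₂ n₂ 𝕜} :
    columnFactor μ a K * fromRows N₁ N₂ = fromRows (defect μ aᴴ * N₁)
      (-(K * aᴴ * N₁) + (μ : 𝕜) • (defect 1 Kᴴ * N₂)) := by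
  rw [columnFactor, fromBlocks_mul_fromRows, Matrix.zero_mul, add_zero, Matrix.neg_mul,
    Matrix.smul_mul]

theorem gram_le_columnFactor_of_contraction [Fintype n₂] [DecidableEq n₂] {a : Matrix m₁ n₁ 𝕜}
    {K : Matrix m₂ n₁ 𝕜} {L : Matrix m₁ n₂ 𝕜} {Z : Matrix m₂ n₂ 𝕜}
    (hL : spectralNorm L ≤ 1) (hZ : spectralNorm Z ≤ 1) :
    fromRows (defect μ aᴴ * L)
        (-(K * aᴴ * L) + (μ : 𝕜) • (defect 1 Kᴴ * Z * defect 1 L)) *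
      (fromRows (defect μ aᴴ * L)
        (-(K * aᴴ * L) + (μ : 𝕜) • (defect 1 Kᴴ * Z * defect 1 L)))ᴴ ≤
      columnFactor μ a K * (columnFactor μ a K)ᴴ := by
  have hN : spectralNorm (fromRows L (Z * defect 1 L)) ≤ 1 := by
    rw [spectralNorm_fromRows_le_iff zero_le_one, ← le_sub_iff_add_le',
      ← defect_mul_self zero_le_one hL]
    simpa only [conjTranspose_mul, defect_conjTranspose, Matrix.mul_assoc, Matrix.one_mul] using
      conjTranspose_mul_mul_le (spectralNorm_le_one_iff.1 hZ) (defect 1 L)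
  rw [Matrix.mul_assoc (defect 1 Kᴴ), ← columnFactor_mul_fromRows]
  exact gram_mul_le hN

variable [DecidableEq n₁]

theorem columnFactor_mul_conjTranspose (hμ : 0 ≤ μ) {a : Matrix m₁ n₁ 𝕜} {K : Matrix m₂ n₁ 𝕜}
    (ha : spectralNorm a ≤ μ) (hK : spectralNorm K ≤ 1) :
    columnFactor μ a K * (columnFactor μ a K)ᴴ = (μ : 𝕜) ^ 2 • 1 -
      fromRows a (K * defect μ a) * (fromRows a (K * defect μ a))ᴴ := by
  have hE : defect μ aᴴ * defect μ aᴴ = (μ : 𝕜) ^ 2 • 1 - a * aᴴ := by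
    rw [defect_mul_self hμ (by rwa [spectralNorm_conjTranspose]), conjTranspose_conjTranspose]
  have hR : defect 1 Kᴴ * defect 1 Kᴴ = 1 - K * Kᴴ := by
    rw [defect_mul_self zero_le_one (by rwa [spectralNorm_conjTranspose]),
      conjTranspose_conjTranspose, RCLike.ofReal_one, one_pow, one_smul]
  have hoff : defect μ aᴴ * (a * Kᴴ) = a * (K * defect μ a)ᴴ := by
    rw [conjTranspose_mul, defect_conjTranspose, ← Matrix.mul_assoc, ← mul_defect,
      Matrix.mul_assoc]
  have hdiag : K * defect μ a * (K * defect μ a)ᴴ =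
      (μ : 𝕜) ^ 2 • (K * Kᴴ) - K * aᴴ * (a * Kᴴ) := by
    rw [conjTranspose_mul, defect_conjTranspose, Matrix.mul_assoc, ← Matrix.mul_assoc _ _ Kᴴ,
      defect_mul_self hμ ha]
    simp only [Matrix.mul_sub, Matrix.sub_mul, Matrix.mul_smul, Matrix.smul_mul, Matrix.one_mul,
      Matrix.mul_assoc]
  rw [columnFactor_conjTranspose, columnFactor, fromBlocks_multiply,
    conjTranspose_fromRows_eq_fromCols_conjTranspose, fromRows_mul_fromCols, ← fromBlocks_one,
    fromBlocks_smul, sub_eq_add_neg, fromBlocks_neg, fromBlocks_add, fromBlocks_inj]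
  refine ⟨?_, ?_, ?_, ?_⟩
  · rw [Matrix.zero_mul, hE]; abel
  · simp [hoff]
  · rw [← conjTranspose_inj]
    simp [hoff, defect_conjTranspose]
  · rw [hdiag, Matrix.smul_mul, Matrix.mul_smul, hR, smul_smul, ← pow_two, Matrix.neg_mul,
      Matrix.mul_neg, neg_neg, smul_sub]
    abel

theorem exists_toRows₁_pinv_columnFactor_mul (a : Matrix m₁ n₁ 𝕜) {K : Matrix m₂ n₁ 𝕜}
    (hK : K * (defect μ a * pinv (defect μ a)) = K) (T : Matrix (m₁ ⊕ m₂) n₂ 𝕜) :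
    ∃ G : Matrix m₁ n₂ 𝕜, (pinv (columnFactor μ a K) * T).toRows₁ = defect μ aᴴ * G := by
  set W := columnFactor μ a K
  set D := defect μ a
  set V := (pinv W)ᴴ * (pinv W * T)
  have hrange : pinv W * T = Wᴴ * fromRows V.toRows₁ V.toRows₂ := by
    rw [fromRows_toRows, ← Matrix.mul_assoc, ← conjTranspose_mul, (pinv_spec W).right_herm,
      ← Matrix.mul_assoc, pinv_mul_mul_pinv]
  have hK_conj : D * pinv D * Kᴴ = Kᴴ := by
    rw [← (pinv_spec D).left_herm, ← conjTranspose_mul, hK]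
  have haK : a * Kᴴ = defect μ aᴴ * (a * (pinv D * Kᴴ)) := by
    rw [← Matrix.mul_assoc, ← mul_defect, Matrix.mul_assoc, ← Matrix.mul_assoc D, hK_conj]
  refine ⟨V.toRows₁ - a * (pinv D * Kᴴ) * V.toRows₂, ?_⟩
  rw [hrange, columnFactor_conjTranspose, fromBlocks_mul_fromRows, toRows₁_fromRows, haK,
    Matrix.mul_sub, Matrix.neg_mul, sub_eq_add_neg, Matrix.mul_assoc (defect μ aᴴ)]

theorem toRows₁_pinv_columnFactor_mul (a : Matrix m₁ n₁ 𝕜) {b : Matrix m₁ n₂ 𝕜}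
    {K : Matrix m₂ n₁ 𝕜} {x : Matrix m₂ n₂ 𝕜}
    (hK : K * (defect μ a * pinv (defect μ a)) = K)
    (h : columnFactor μ a K * (pinv (columnFactor μ a K) * fromRows b x) = fromRows b x) :
    (pinv (columnFactor μ a K) * fromRows b x).toRows₁ = pinv (defect μ aᴴ) * b := by
  obtain ⟨G, hG⟩ := exists_toRows₁_pinv_columnFactor_mul a hK (fromRows b x)
  set N := pinv (columnFactor μ a K) * fromRows b x
  rw [← fromRows_toRows N, columnFactor_mul_fromRows] at h
  have hb : defect μ aᴴ * N.toRows₁ = b := (fromRows_inj h).1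
  rw [← hb, hG, ← Matrix.mul_assoc (pinv _),
    pinv_mul_eq_mul_pinv_of_conjTranspose (defect_conjTranspose μ aᴴ), ← Matrix.mul_assoc,
    mul_pinv_mul_self]

variable [Fintype n₂] [DecidableEq n₂]

theorem spectralNorm_fromBlocks_le_iff_gram_le (hμ : 0 ≤ μ) {a : Matrix m₁ n₁ 𝕜}
    {b : Matrix m₁ n₂ 𝕜} {K : Matrix m₂ n₁ 𝕜} {x : Matrix m₂ n₂ 𝕜}
    (ha : spectralNorm a ≤ μ) (hK : spectralNorm K ≤ 1) :
    spectralNorm (fromBlocks a b (K * defect μ a) x) ≤ μ ↔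
      fromRows b x * (fromRows b x)ᴴ ≤ columnFactor μ a K * (columnFactor μ a K)ᴴ := by
  rw [columnFactor_mul_conjTranspose hμ ha hK, le_sub_iff_add_le',
    ← spectralNorm_fromCols_le_iff hμ, fromCols_fromRows_eq_fromBlocks]

theorem exists_contraction_of_gram_le_columnFactor {a : Matrix m₁ n₁ 𝕜} {b : Matrix m₁ n₂ 𝕜}
    {K : Matrix m₂ n₁ 𝕜} {x : Matrix m₂ n₂ 𝕜}
    (hK : K * (defect μ a * pinv (defect μ a)) = K)
    (h : fromRows b x * (fromRows b x)ᴴ ≤ columnFactor μ a K * (columnFactor μ a K)ᴴ) :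
    ∃ Z : Matrix m₂ n₂ 𝕜, spectralNorm Z ≤ 1 ∧ x = -(K * aᴴ * (pinv (defect μ aᴴ) * b)) +
      (μ : 𝕜) • (defect 1 Kᴴ * Z * defect 1 (pinv (defect μ aᴴ) * b)) := by
  have hfactor := mul_pinv_mul_of_gram_le h
  have hnorm := spectralNorm_pinv_mul_le_one h
  have hL := toRows₁_pinv_columnFactor_mul a hK hfactor
  set N := pinv (columnFactor μ a K) * fromRows b x
  set L := pinv (defect μ aᴴ) * b
  rw [← fromRows_toRows N, hL] at hfactor hnorm
  rw [columnFactor_mul_fromRows] at hfactor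
  rw [spectralNorm_fromRows_le_iff zero_le_one] at hnorm
  have hL_le : spectralNorm L ≤ 1 := (spectralNorm_le_iff zero_le_one).2 <|
    (le_add_of_nonneg_right (posSemidef_conjTranspose_mul_self _).nonneg).trans hnorm
  have hgram : N.toRows₂ᴴ * N.toRows₂ ≤ (defect 1 L)ᴴ * defect 1 L := by
    rwa [defect_conjTranspose, defect_mul_self zero_le_one hL_le, le_sub_iff_add_le']
  refine ⟨N.toRows₂ * pinv (defect 1 L), spectralNorm_mul_pinv_le_one hgram, ?_⟩
  rw [Matrix.mul_assoc (defect 1 Kᴴ), mul_pinv_mul_of_gram_le' hgram]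
  exact (fromRows_inj hfactor).2.symm

theorem spectralNorm_fromBlocks_le_iff (hμ : 0 ≤ μ) {a : Matrix m₁ n₁ 𝕜} {b : Matrix m₁ n₂ 𝕜}
    {c : Matrix m₂ n₁ 𝕜} (hcol : spectralNorm (fromRows a c) ≤ μ)
    (hrow : spectralNorm (fromCols a b) ≤ μ) {K : Matrix m₂ n₁ 𝕜} {L : Matrix m₁ n₂ 𝕜}
    (hK : K = c * pinv (defect μ a)) (hL : L = pinv (defect μ aᴴ) * b) (x : Matrix m₂ n₂ 𝕜) :
    spectralNorm (fromBlocks a b c x) ≤ μ ↔ ∃ Z : Matrix m₂ n₂ 𝕜, spectralNorm Z ≤ 1 ∧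
      x = -(K * aᴴ * L) + (μ : 𝕜) • (defect 1 Kᴴ * Z * defect 1 L) := by
  have ha := spectralNorm_left_le_of_fromCols_le hμ hrow
  have hgram := gram_le_gram_defect hμ ha hcol
  have hgram' := gram_le_gram_defect' hμ ha hrow
  have hK_le : spectralNorm K ≤ 1 := hK ▸ spectralNorm_mul_pinv_le_one hgram
  have hL_le : spectralNorm L ≤ 1 := hL ▸ spectralNorm_pinv_mul_le_one hgram'
  have hKD : K * defect μ a = c := by rw [hK, mul_pinv_mul_of_gram_le' hgram]
  have hKD' : K * (defect μ a * pinv (defect μ a)) = K := by rw [← Matrix.mul_assoc, hKD, hK]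
  have hEL : defect μ aᴴ * L = b := by rw [hL, mul_pinv_mul_of_gram_le hgram']
  rw [← hKD, spectralNorm_fromBlocks_le_iff_gram_le hμ ha hK_le]
  constructor
  · rw [hL]
    exact exists_contraction_of_gram_le_columnFactor hKD'
  · rintro ⟨Z, hZ, rfl⟩
    rw [← hEL]
    exact gram_le_columnFactor_of_contraction hL_le hZ

end

/-! ### Transposition of either kind and the prototype classes -/

namespace FormKind

section

variable {l m n : Type*} (k : FormKind)

theorem tr_mul [Fintype m] (A : Matrix l m 𝕜) (B : Matrix m n 𝕜) :
    k.tr (A * B) = k.tr B * k.tr A := by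
  cases k <;> simp [tr]

theorem tr_add (A B : Matrix m n 𝕜) : k.tr (A + B) = k.tr A + k.tr B := by
  cases k <;> simp [tr]

theorem tr_sub (A B : Matrix m n 𝕜) : k.tr (A - B) = k.tr A - k.tr B := by
  cases k <;> simp [tr]

theorem tr_tr (A : Matrix m n 𝕜) : k.tr (k.tr A) = A := by
  cases k <;> simp [tr]

theorem tr_zero : k.tr (0 : Matrix m n 𝕜) = 0 := by
  cases k <;> simp [tr]

theorem tr_one [DecidableEq n] : k.tr (1 : Matrix n n 𝕜) = 1 := by
  cases k <;> simp [tr]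

theorem tr_zsmul (ε : ℤ) (A : Matrix m n 𝕜) : k.tr (ε • A) = ε • k.tr A := by
  cases k <;> ext <;> simp [tr]

theorem tr_ofReal_smul (t : ℝ) (A : Matrix m n 𝕜) : k.tr ((t : 𝕜) • A) = (t : 𝕜) • k.tr A := by
  cases k <;> ext <;> simp [tr, RCLike.real_smul_eq_coe_mul]

theorem tr_fromRows {m₁ m₂ : Type*} (A : Matrix m₁ n 𝕜) (B : Matrix m₂ n 𝕜) :
    k.tr (fromRows A B) = fromCols (k.tr A) (k.tr B) := by
  cases k
  · exact transpose_fromRows A B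
  · exact conjTranspose_fromRows_eq_fromCols_conjTranspose A B

theorem tr_fromCols {n₁ n₂ : Type*} (A : Matrix m n₁ 𝕜) (B : Matrix m n₂ 𝕜) :
    k.tr (fromCols A B) = fromRows (k.tr A) (k.tr B) := by
  cases k
  · exact transpose_fromCols A B
  · exact conjTranspose_fromCols_eq_fromRows_conjTranspose A B

theorem tr_conjTranspose (A : Matrix m n 𝕜) : k.tr Aᴴ = (k.tr A)ᴴ := by
  cases k <;> ext <;> simp [tr]

end

variable (k : FormKind)

theorem spectralNorm_tr [DecidableEq m] [DecidableEq n] (A : Matrix m n 𝕜) :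
    spectralNorm (k.tr A) = spectralNorm A := by
  cases k
  · exact spectralNorm_transpose A
  · exact spectralNorm_conjTranspose A

theorem tr_pinv [DecidableEq m] [DecidableEq n] (X : Matrix m n 𝕜) :
    k.tr (pinv X) = pinv (k.tr X) := by
  cases k
  · exact (pinv_transpose X).symm
  · exact (pinv_conjTranspose X).symm

theorem tr_psdSqrt [DecidableEq n] {P : Matrix n n 𝕜} (hP : Pᴴ = P) :
    k.tr (psdSqrt P) = psdSqrt (k.tr P) := by
  cases k
  · exact (cfc_transpose Real.sqrt hP).symm
  · rw [tr, tr, psdSqrt_conjTranspose, hP]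

theorem tr_defect [DecidableEq n] (μ : ℝ) (A : Matrix m n 𝕜) :
    k.tr (defect μ A) = defect μ (k.tr A)ᴴ := by
  classical
  rw [defect, k.tr_psdSqrt (conjTranspose_smul_one_sub_gram μ A), defect,
    conjTranspose_conjTranspose, tr_sub, tr_mul, tr_conjTranspose, ← RCLike.ofReal_pow,
    tr_ofReal_smul, tr_one]

theorem isStarProjection_tr {P : Matrix n n 𝕜} (hP : IsStarProjection P) :
    IsStarProjection (k.tr P) where
  isIdempotentElem := by rw [IsIdempotentElem, ← tr_mul, hP.isIdempotentElem.eq]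
  isSelfAdjoint := by
    rw [IsSelfAdjoint, star_eq_conjTranspose, ← tr_conjTranspose, ← star_eq_conjTranspose,
      hP.isSelfAdjoint.star_eq]

end FormKind

/-- The real space of matrices `A` with `A^* = ε A`; for `ε = ±1` these are the four prototype
classes. -/
def prototype {n : Type*} (k : FormKind) (ε : ℤ) : Submodule ℝ (Matrix n n 𝕜) where
  carrier := {A | k.tr A = ε • A}
  add_mem' {A B} hA hB := by
    rw [Set.mem_ofPred_eq] at hA hB ⊢
    rw [k.tr_add, hA, hB, smul_add]
  zero_mem' := by rw [Set.mem_ofPred_eq, k.tr_zero, smul_zero]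
  smul_mem' t A hA := by
    rw [Set.mem_ofPred_eq] at hA ⊢
    rw [RCLike.real_smul_eq_coe_smul (K := 𝕜), k.tr_ofReal_smul, hA, smul_comm]

section

variable {n : Type*} {k : FormKind} {ε : ℤ} {A : Matrix n n 𝕜}

theorem mem_prototype : A ∈ prototype k ε ↔ k.tr A = ε • A :=
  Iff.rfl

theorem ofReal_smul_mem_prototype (hA : A ∈ prototype k ε) (t : ℝ) :
    (t : 𝕜) • A ∈ prototype k ε := by
  rw [← RCLike.real_smul_eq_coe_smul]
  exact Submodule.smul_mem _ t hA

theorem conjTranspose_mem_prototype (hA : A ∈ prototype k ε) : Aᴴ ∈ prototype k ε := by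
  rw [mem_prototype, k.tr_conjTranspose, hA, conjTranspose_zsmul]

theorem add_zsmul_tr_mem_prototype (hε : ε * ε = 1) (A : Matrix n n 𝕜) :
    A + ε • k.tr A ∈ prototype k ε := by
  rw [mem_prototype, k.tr_add, k.tr_zsmul, k.tr_tr, smul_add, smul_smul, hε, one_smul, add_comm]

theorem zsmul_tr_eq_of_mem_prototype (hε : ε * ε = 1) (hA : A ∈ prototype k ε) :
    ε • k.tr A = A := by
  rw [hA, smul_smul, hε, one_smul]

end

theorem mul_mul_tr_mem_prototype {k : FormKind} {ε : ℤ} {A : Matrix n n 𝕜}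
    (hA : A ∈ prototype k ε) {m : Type*} (R : Matrix m n 𝕜) :
    R * A * k.tr R ∈ prototype k ε := by
  rw [mem_prototype, k.tr_mul, k.tr_mul, k.tr_tr, hA, Matrix.smul_mul, Matrix.mul_smul,
    ← Matrix.mul_assoc]

theorem spectralNorm_zsmul [DecidableEq n] {ε : ℤ} (hε : ε * ε = 1) (A : Matrix m n 𝕜) :
    spectralNorm (ε • A) = spectralNorm A := by
  have hnorm : ‖(ε : 𝕜)‖ = 1 := by
    rcases mul_self_eq_one_iff.1 hε with rfl | rfl <;> simp
  rw [← Int.cast_smul_eq_zsmul 𝕜, spectralNorm_smul, hnorm, one_mul]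

theorem defect_zsmul [DecidableEq n] {ε : ℤ} (hε : ε * ε = 1) (μ : ℝ) (A : Matrix m n 𝕜) :
    defect μ (ε • A) = defect μ A := by
  rw [defect, defect, conjTranspose_zsmul, Matrix.smul_mul, Matrix.mul_smul, smul_smul, hε,
    one_smul]

theorem tr_defect_of_mem_prototype [DecidableEq n] {k : FormKind} {ε : ℤ} (hε : ε * ε = 1)
    {A : Matrix n n 𝕜} (hA : A ∈ prototype k ε) (μ : ℝ) :
    k.tr (defect μ A) = defect μ Aᴴ := by
  rw [k.tr_defect, hA, conjTranspose_zsmul, defect_zsmul hε]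

theorem exists_contraction_mem_prototype [DecidableEq n] {k : FormKind} {ε : ℤ} (hε : ε * ε = 1)
    {t : ℝ} {R Z : Matrix n n 𝕜} (hZ : spectralNorm Z ≤ 1)
    (h : (t : 𝕜) • (R * Z * k.tr R) ∈ prototype k ε) :
    ∃ Z' ∈ prototype k ε, spectralNorm Z' ≤ 1 ∧
      (t : 𝕜) • (R * Z * k.tr R) = (t : 𝕜) • (R * Z' * k.tr R) := by
  refine ⟨((1 / 2 : ℝ) : 𝕜) • (Z + ε • k.tr Z),
    ofReal_smul_mem_prototype (add_zsmul_tr_mem_prototype hε Z) _, ?_, ?_⟩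
  · have hsum := spectralNorm_add_le Z (ε • k.tr Z)
    rw [spectralNorm_zsmul hε, k.spectralNorm_tr] at hsum
    rw [spectralNorm_smul, RCLike.norm_ofReal, abs_of_pos one_half_pos]
    linarith
  · have hhalf : ((1 / 2 : ℝ) : 𝕜) * 2 = 1 := by push_cast; exact one_div_mul_cancel two_ne_zero
    have htr : (t : 𝕜) • (R * (ε • k.tr Z) * k.tr R) = (t : 𝕜) • (R * Z * k.tr R) := by
      rw [← zsmul_tr_eq_of_mem_prototype hε h, k.tr_ofReal_smul, k.tr_mul, k.tr_mul, k.tr_tr,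
        Matrix.mul_smul, Matrix.smul_mul, Matrix.mul_assoc, smul_comm]
    rw [Matrix.mul_smul, Matrix.smul_mul, smul_comm, Matrix.mul_add, Matrix.add_mul, smul_add,
      htr, ← two_smul 𝕜, smul_smul, hhalf, one_smul]

theorem fromCols_zsmul {m n₁ n₂ : Type*} (ε : ℤ) (A : Matrix m n₁ 𝕜) (B : Matrix m n₂ 𝕜) :
    ε • fromCols A B = fromCols (ε • A) (ε • B) := by
  ext i (j | j) <;> rfl

/-! ### The structured dilation theorem -/

section

variable [DecidableEq m] [DecidableEq n] {k : FormKind} {ε : ℤ} {μ : ℝ}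

theorem spectralNorm_fromBlocks_le_iff_of_mem_prototype (hε : ε * ε = 1) (hμ : 0 ≤ μ)
    {a : Matrix m m 𝕜} (ha : a ∈ prototype k ε) {c K : Matrix n m 𝕜}
    (hcol : spectralNorm (fromRows a c) ≤ μ) (hK : K = c * pinv (defect μ a))
    (x : Matrix n n 𝕜) :
    spectralNorm (fromBlocks a (ε • k.tr c) c x) ≤ μ ↔ ∃ Z : Matrix n n 𝕜, spectralNorm Z ≤ 1 ∧
      x = -(ε • (K * aᴴ * k.tr K)) + (μ : 𝕜) • (defect 1 Kᴴ * Z * k.tr (defect 1 Kᴴ)) := by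
  have hrow : spectralNorm (fromCols a (ε • k.tr c)) ≤ μ := by
    have htr : k.tr (fromRows a c) = ε • fromCols a (ε • k.tr c) := by
      rw [k.tr_fromRows, mem_prototype.1 ha, fromCols_zsmul, smul_smul, hε, one_smul]
    rwa [← spectralNorm_zsmul hε, ← htr, k.spectralNorm_tr]
  have hL : ε • k.tr K = pinv (defect μ aᴴ) * (ε • k.tr c) := by
    rw [hK, k.tr_mul, k.tr_pinv, tr_defect_of_mem_prototype hε ha, Matrix.mul_smul]
  have hdefect : defect 1 (ε • k.tr K) = k.tr (defect 1 Kᴴ) := by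
    rw [defect_zsmul hε, k.tr_defect, k.tr_conjTranspose, conjTranspose_conjTranspose]
  rw [spectralNorm_fromBlocks_le_iff hμ hcol hrow hK hL, hdefect, Matrix.mul_smul]

theorem structured_spectralNorm_fromBlocks_le_iff (hε : ε * ε = 1) (hμ : 0 ≤ μ)
    {a : Matrix m m 𝕜} (ha : a ∈ prototype k ε) {c K : Matrix n m 𝕜}
    (hcol : spectralNorm (fromRows a c) ≤ μ) (hK : K = c * pinv (defect μ a))
    (x : Matrix n n 𝕜) :
    x ∈ prototype k ε ∧ spectralNorm (fromBlocks a (ε • k.tr c) c x) ≤ μ ↔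
      ∃ Z ∈ prototype k ε, spectralNorm Z ≤ 1 ∧
        x = -(ε • (K * aᴴ * k.tr K)) + (μ : 𝕜) • (defect 1 Kᴴ * Z * k.tr (defect 1 Kᴴ)) := by
  rw [spectralNorm_fromBlocks_le_iff_of_mem_prototype hε hμ ha hcol hK]
  have hcorner : -(ε • (K * aᴴ * k.tr K)) ∈ prototype k ε := by
    exact neg_mem <| zsmul_mem
      (mul_mul_tr_mem_prototype (conjTranspose_mem_prototype ha) K) ε
  constructor
  · rintro ⟨hx, Z, hZ, rfl⟩
    obtain ⟨Z', hmem, hZ', hZZ'⟩ := exists_contraction_mem_prototype hε hZ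
      (by simpa only [add_sub_cancel_left] using sub_mem hx hcorner)
    exact ⟨Z', hmem, hZ', by rw [hZZ']⟩
  · rintro ⟨Z, hmem, hZ, rfl⟩
    exact ⟨add_mem hcorner
      (ofReal_smul_mem_prototype (mul_mul_tr_mem_prototype hmem _) μ), Z, hZ, rfl⟩

end

/-! ### Structured solutions -/

/-- The solutions of `H X = N` in a prototype class. -/
abbrev prototypeSolutions {n p : Type*} [Fintype n] (k : FormKind) (ε : ℤ) (X N : Matrix n p 𝕜) :
    Set (Matrix n n 𝕜) :=
  solutionSet (prototype k ε : Submodule ℝ (Matrix n n 𝕜)) X N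

theorem tr_mul_mul_mem_prototype {k : FormKind} {ε : ℤ} {H : Matrix n n 𝕜}
    (hH : H ∈ prototype k ε) {m : Type*} (R : Matrix n m 𝕜) : k.tr R * H * R ∈ prototype k ε := by
  simpa only [k.tr_tr] using mul_mul_tr_mem_prototype hH (k.tr R)

section

variable [DecidableEq n] [DecidableEq p] {k : FormKind} {ε : ℤ} {X N : Matrix n p 𝕜}
  {H : Matrix n n 𝕜}

theorem solMap_eq (hε : ε * ε = 1) (hH : H ∈ prototypeSolutions k ε X N) :
    solMap k ε X N = H - k.tr (1 - X * pinv X) * H * (1 - X * pinv X) := by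
  obtain ⟨hmem, rfl⟩ := hH
  have htr : ε • k.tr (H * (X * pinv X)) = k.tr (X * pinv X) * H := by
    rw [k.tr_mul, ← Matrix.mul_smul, zsmul_tr_eq_of_mem_prototype hε hmem]
  have hcorner : k.tr (pinv X) * (k.tr X * (H * X)) * pinv X =
      k.tr (X * pinv X) * H * (X * pinv X) := by
    simp only [k.tr_mul, Matrix.mul_assoc]
  rw [solMap, Matrix.mul_assoc H, htr, hcorner, k.tr_sub, k.tr_one]
  noncomm_ring

omit [DecidableEq n] in
theorem solMap_mem_solutionSet (hε : ε * ε = 1) (hH : H ∈ prototypeSolutions k ε X N) :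
    solMap k ε X N ∈ prototypeSolutions k ε X N := by
  classical
  rw [solMap_eq hε hH]
  refine ⟨sub_mem hH.1 (tr_mul_mul_mem_prototype hH.1 _), ?_⟩
  rw [Matrix.sub_mul, Matrix.mul_assoc _ _ X, one_sub_mul_pinv_mul, Matrix.mul_zero, sub_zero,
    hH.2]

theorem mem_solutionSet_prototype_iff (hε : ε * ε = 1)
    (hH : H ∈ prototypeSolutions k ε X N) {G : Matrix n n 𝕜} :
    G ∈ prototypeSolutions k ε X N ↔ ∃ Z ∈ prototype k ε,
      G = solMap k ε X N + k.tr (1 - X * pinv X) * Z * (1 - X * pinv X) := by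
  constructor
  · intro hG
    exact ⟨G, hG.1, by rw [solMap_eq hε hG, sub_add_cancel]⟩
  · rintro ⟨Z, hZ, rfl⟩
    have hF := solMap_mem_solutionSet hε hH
    refine ⟨add_mem hF.1 (tr_mul_mul_mem_prototype hZ _), ?_⟩
    rw [Matrix.add_mul, Matrix.mul_assoc _ _ X, one_sub_mul_pinv_mul, Matrix.mul_zero, add_zero,
      hF.2]

theorem tr_one_sub_mul_solMap_mul (hε : ε * ε = 1)
    (hH : H ∈ prototypeSolutions k ε X N) :
    k.tr (1 - X * pinv X) * solMap k ε X N * (1 - X * pinv X) = 0 := by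
  have hQ := (isStarProjection_mul_pinv X).one_sub.isIdempotentElem.eq
  rw [solMap_eq hε hH]
  generalize 1 - X * pinv X = Q at hQ ⊢
  calc k.tr Q * (H - k.tr Q * H * Q) * Q
      = k.tr Q * H * Q - k.tr (Q * Q) * H * (Q * Q) := by rw [k.tr_mul]; noncomm_ring
    _ = 0 := by rw [hQ, sub_self]

end

/-! ### The Frobenius norm -/

section

open scoped Matrix.Norms.Frobenius in
theorem frobeniusNorm_nonneg (A : Matrix m n 𝕜) : 0 ≤ frobeniusNorm A :=
  norm_nonneg A

open scoped Matrix.Norms.Frobenius in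
theorem frobeniusNorm_eq_zero {A : Matrix m n 𝕜} : frobeniusNorm A = 0 ↔ A = 0 :=
  norm_eq_zero

open scoped Matrix.Norms.Frobenius in
theorem FormKind.frobeniusNorm_tr (k : FormKind) (A : Matrix m n 𝕜) :
    frobeniusNorm (k.tr A) = frobeniusNorm A := by
  cases k
  · exact frobenius_norm_transpose A
  · exact frobenius_norm_conjTranspose A

open scoped Matrix.Norms.Frobenius in
theorem frobeniusNorm_zsmul {ε : ℤ} (hε : ε * ε = 1) (A : Matrix m n 𝕜) :
    frobeniusNorm (ε • A) = frobeniusNorm A := by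
  rcases mul_self_eq_one_iff.1 hε with rfl | rfl
  · rw [one_smul]
  · rw [neg_one_smul]; exact norm_neg A

open scoped Matrix.Norms.Frobenius in
theorem ofReal_frobeniusNorm_sq (A : Matrix m n 𝕜) :
    ((frobeniusNorm A ^ 2 : ℝ) : 𝕜) = trace (A * Aᴴ) := by
  rw [frobeniusNorm, frobenius_norm_def, ← Real.sqrt_eq_rpow, Real.sq_sqrt (by positivity)]
  simp [trace, mul_apply, RCLike.mul_conj]

theorem trace_mul_conjTranspose_mul_of_isStarProjection {P : Matrix m m 𝕜}
    (hP : IsStarProjection P) (A : Matrix m n 𝕜) :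
    trace (A * Aᴴ * P) = ((frobeniusNorm (P * A) ^ 2 : ℝ) : 𝕜) := by
  have hself : Pᴴ = P := hP.isSelfAdjoint
  calc trace (A * Aᴴ * P) = trace (A * Aᴴ * (P * P)) := by rw [hP.isIdempotentElem.eq]
    _ = trace (P * A * (P * A)ᴴ) := by
      rw [← Matrix.mul_assoc, trace_mul_comm, conjTranspose_mul, hself]
      simp only [Matrix.mul_assoc]
    _ = _ := (ofReal_frobeniusNorm_sq _).symm

theorem frobeniusNorm_sq_eq_add [DecidableEq m] {P : Matrix m m 𝕜} (hP : IsStarProjection P)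
    (A : Matrix m n 𝕜) :
    frobeniusNorm A ^ 2 = frobeniusNorm (P * A) ^ 2 + frobeniusNorm ((1 - P) * A) ^ 2 := by
  apply RCLike.ofReal_injective (K := 𝕜)
  rw [RCLike.ofReal_add, ← trace_mul_conjTranspose_mul_of_isStarProjection hP,
    ← trace_mul_conjTranspose_mul_of_isStarProjection hP.one_sub, ofReal_frobeniusNorm_sq,
    ← trace_add, ← Matrix.mul_add, add_sub_cancel, Matrix.mul_one]

theorem frobeniusNorm_sq_eq_add' [DecidableEq n] {P : Matrix n n 𝕜} (hP : IsStarProjection P)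
    (A : Matrix m n 𝕜) :
    frobeniusNorm A ^ 2 = frobeniusNorm (A * P) ^ 2 + frobeniusNorm (A * (1 - P)) ^ 2 := by
  have hadjoint (A : Matrix m n 𝕜) : frobeniusNorm A = frobeniusNorm Aᴴ :=
    (FormKind.sesquilinear.frobeniusNorm_tr A).symm
  have hP' : Pᴴ = P := hP.isSelfAdjoint
  have hQ' : (1 - P)ᴴ = 1 - P := hP.one_sub.isSelfAdjoint
  rw [hadjoint A, hadjoint (A * P), hadjoint (A * (1 - P)), conjTranspose_mul, conjTranspose_mul,
    hP', hQ', frobeniusNorm_sq_eq_add hP Aᴴ]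

theorem frobeniusNorm_isometry_mul [DecidableEq n] {V : Matrix m n 𝕜} (hV : Vᴴ * V = 1)
    (A : Matrix n l 𝕜) : frobeniusNorm (V * A) = frobeniusNorm A := by
  refine (sq_eq_sq₀ (frobeniusNorm_nonneg _) (frobeniusNorm_nonneg _)).1
    (RCLike.ofReal_injective (K := 𝕜) ?_)
  rw [ofReal_frobeniusNorm_sq, ofReal_frobeniusNorm_sq, conjTranspose_mul, Matrix.mul_assoc,
    trace_mul_comm, Matrix.mul_assoc, Matrix.mul_assoc, hV, Matrix.mul_one]

variable [DecidableEq n] [DecidableEq p] {k : FormKind} {ε : ℤ} {X N : Matrix n p 𝕜}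
  {H : Matrix n n 𝕜}

theorem frobeniusNorm_solution_sq (hε : ε * ε = 1)
    (hH : H ∈ prototypeSolutions k ε X N) :
    frobeniusNorm H ^ 2 = 2 * frobeniusNorm (N * pinv X) ^ 2
      - frobeniusNorm (k.tr (X * pinv X) * (N * pinv X)) ^ 2
      + frobeniusNorm (k.tr (1 - X * pinv X) * H * (1 - X * pinv X)) ^ 2 := by
  obtain ⟨hmem, rfl⟩ := hH
  have hP := isStarProjection_mul_pinv X
  rw [Matrix.mul_assoc H]
  generalize X * pinv X = P at hP ⊢
  have hTP : IsStarProjection (k.tr P) := k.isStarProjection_tr hP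
  have hQ : k.tr (1 - P) = 1 - k.tr P := by rw [k.tr_sub, k.tr_one]
  have hcross : frobeniusNorm (k.tr P * (H * (1 - P))) =
      frobeniusNorm ((1 - k.tr P) * (H * P)) := by
    rw [← k.frobeniusNorm_tr, k.tr_mul, k.tr_mul, k.tr_tr, mem_prototype.1 hmem, Matrix.mul_smul,
      Matrix.smul_mul, frobeniusNorm_zsmul hε, hQ, Matrix.mul_assoc]
  have hcols := frobeniusNorm_sq_eq_add' hP H
  have hleft := frobeniusNorm_sq_eq_add hTP (H * P)
  have hright := frobeniusNorm_sq_eq_add hTP (H * (1 - P))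
  rw [hcross] at hright
  rw [hQ, Matrix.mul_assoc (1 - k.tr P)]
  linarith

omit [DecidableEq n] in
theorem frobeniusNorm_solMap_sq (hε : ε * ε = 1) (hH : H ∈ prototypeSolutions k ε X N) :
    frobeniusNorm (solMap k ε X N) ^ 2 = 2 * frobeniusNorm (N * pinv X) ^ 2
      - frobeniusNorm (k.tr (X * pinv X) * (N * pinv X)) ^ 2 := by
  classical
  rw [frobeniusNorm_solution_sq hε (solMap_mem_solutionSet hε hH),
    tr_one_sub_mul_solMap_mul hε hH, frobeniusNorm_eq_zero.2 rfl, zero_pow two_ne_zero, add_zero]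

omit [DecidableEq n] in
theorem frobeniusNorm_solution_sq_eq_add (hε : ε * ε = 1)
    (hH : H ∈ prototypeSolutions k ε X N) :
    frobeniusNorm H ^ 2 =
      frobeniusNorm (solMap k ε X N) ^ 2 + frobeniusNorm (H - solMap k ε X N) ^ 2 := by
  classical
  rw [frobeniusNorm_solMap_sq hε hH, frobeniusNorm_solution_sq hε hH, solMap_eq hε hH,
    sub_sub_cancel]

end

/-! ### Splitting the space along a projection -/

/-- The columns of `U₁` and of `U₂` are orthonormal bases of the range and of the kernel of the
orthogonal projection `P`. -/
structure IsSplitting [DecidableEq l] [DecidableEq m] [DecidableEq n] (P : Matrix n n 𝕜)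
    (U₁ : Matrix n l 𝕜) (U₂ : Matrix n m 𝕜) : Prop where
  isometry_left : U₁ᴴ * U₁ = 1
  isometry_right : U₂ᴴ * U₂ = 1
  range_eq : U₁ * U₁ᴴ = P
  kernel_eq : U₂ * U₂ᴴ = 1 - P

section

variable [DecidableEq n]

theorem submatrix_isometry {U : Matrix n n 𝕜} (hU : U ∈ unitaryGroup n 𝕜) (q : n → Prop) :
    (U.submatrix id (Subtype.val : Subtype q → n))ᴴ *
      U.submatrix id (Subtype.val : Subtype q → n) = 1 := by
  have hUU : Uᴴ * U = 1 := mem_unitaryGroup_iff'.1 hU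
  rw [conjTranspose_submatrix, ← submatrix_mul _ _ _ _ _ Function.bijective_id, hUU]
  exact submatrix_one _ Subtype.val_injective

theorem submatrix_mul_conjTranspose_submatrix (U : Matrix n n 𝕜) (q : n → Prop)
    [DecidablePred q] :
    U.submatrix id (Subtype.val : Subtype q → n) *
      (U.submatrix id (Subtype.val : Subtype q → n))ᴴ =
      U * diagonal (fun i => if q i then 1 else 0) * Uᴴ := by
  ext i j
  rw [mul_apply, mul_apply]
  simp only [submatrix_apply, conjTranspose_apply, id, mul_diagonal, mul_ite, mul_one,
    mul_zero, ite_mul, zero_mul]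
  rw [← Finset.sum_filter]
  exact (Finset.sum_subtype (Finset.univ.filter q) (by simp) fun x => U i x * star (U j x)).symm

theorem isSplitting_of_unitary {U : Matrix n n 𝕜} (hU : U ∈ unitaryGroup n 𝕜)
    {q q' : n → Prop} [DecidablePred q] [DecidablePred q'] (hq : ∀ i, q' i ↔ ¬ q i) :
    IsSplitting (U * diagonal (fun i => if q i then 1 else 0) * Uᴴ)
      (U.submatrix id (Subtype.val : Subtype q → n))
      (U.submatrix id (Subtype.val : Subtype q' → n)) where
  isometry_left := submatrix_isometry hU q
  isometry_right := submatrix_isometry hU q'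
  range_eq := submatrix_mul_conjTranspose_submatrix U q
  kernel_eq := by
    have hUU : U * Uᴴ = 1 := mem_unitaryGroup_iff.1 hU
    have hdiag : diagonal (fun i => if q i then (1 : 𝕜) else 0) +
        diagonal (fun i => if q' i then (1 : 𝕜) else 0) = 1 := by
      rw [diagonal_add, ← diagonal_one]
      congr 1 with i
      by_cases h : q i <;> simp [hq, h]
    rw [submatrix_mul_conjTranspose_submatrix, eq_sub_iff_add_eq', ← Matrix.add_mul,
      ← Matrix.mul_add, hdiag, Matrix.mul_one, hUU]

theorem exists_isSplitting {P : Matrix n n 𝕜} (hP : IsStarProjection P) :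
    ∃ (q : n → Prop) (_ : DecidablePred q) (U₁ : Matrix n {i // q i} 𝕜)
      (U₂ : Matrix n {i // ¬ q i} 𝕜), IsSplitting P U₁ U₂ := by
  classical
  have hself : P.IsHermitian := hP.isSelfAdjoint
  have hspectral := hself.spectral_theorem
  have hd : RCLike.ofReal ∘ hself.eigenvalues =
      fun i => if hself.eigenvalues i = 1 then (1 : 𝕜) else 0 := by
    ext i
    rcases hP.isIdempotentElem.spectrum_subset ℝ (hself.eigenvalues_mem_spectrum_real i)
      with h | h
    · rw [Function.comp_apply, h, if_neg zero_ne_one, RCLike.ofReal_zero]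
    · rw [Function.comp_apply, Set.mem_singleton_iff.1 h, if_pos rfl, RCLike.ofReal_one]
  rw [Unitary.conjStarAlgAut_apply, hd] at hspectral
  have hsplit := isSplitting_of_unitary hself.eigenvectorUnitary.2
    (q := fun i => hself.eigenvalues i = 1) fun _ => Iff.rfl
  rw [← star_eq_conjTranspose, ← hspectral] at hsplit
  exact ⟨_, inferInstance, _, _, hsplit⟩

end

namespace IsSplitting

variable [DecidableEq l] [DecidableEq m] [DecidableEq n] {P : Matrix n n 𝕜} {U₁ : Matrix n l 𝕜}
  {U₂ : Matrix n m 𝕜}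

theorem mul_left (h : IsSplitting P U₁ U₂) : P * U₁ = U₁ := by
  rw [← h.range_eq, Matrix.mul_assoc, h.isometry_left, Matrix.mul_one]

theorem mul_conjTranspose_self (h : IsSplitting P U₁ U₂) :
    fromCols U₁ U₂ * (fromCols U₁ U₂)ᴴ = 1 := by
  rw [conjTranspose_fromCols_eq_fromRows_conjTranspose, fromCols_mul_fromRows, h.range_eq,
    h.kernel_eq, add_sub_cancel]

theorem tr_isometry (h : IsSplitting P U₁ U₂) (k : FormKind) :
    (k.tr (fromCols U₁ U₂))ᴴ * k.tr (fromCols U₁ U₂) = 1 := by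
  rw [← k.tr_conjTranspose, ← k.tr_mul, h.mul_conjTranspose_self, k.tr_one]

theorem spectralNorm_fromRows (h : IsSplitting P U₁ U₂) [DecidableEq p] (k : FormKind)
    (A : Matrix n p 𝕜) : spectralNorm (fromRows (k.tr U₁ * A) (k.tr U₂ * A)) = spectralNorm A := by
  rw [← fromRows_mul, ← k.tr_fromCols, spectralNorm_isometry_mul (h.tr_isometry k)]

theorem spectralNorm_fromBlocks (h : IsSplitting P U₁ U₂) (k : FormKind) (A : Matrix n n 𝕜) :
    spectralNorm (fromBlocks (k.tr U₁ * A * U₁) (k.tr U₁ * A * U₂) (k.tr U₂ * A * U₁)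
      (k.tr U₂ * A * U₂)) = spectralNorm A := by
  rw [← fromRows_mul_fromCols, ← fromRows_mul, ← k.tr_fromCols,
    spectralNorm_mul_coisometry h.mul_conjTranspose_self,
    spectralNorm_isometry_mul (h.tr_isometry k)]

theorem spectralNorm_mul_left (h : IsSplitting P U₁ U₂) {A : Matrix p n 𝕜}
    (hA : A * P = A) : spectralNorm (A * U₁) = spectralNorm A := by
  classical
  have hcoisometry : U₁ᴴ * U₁ᴴᴴ = 1 := by rw [conjTranspose_conjTranspose, h.isometry_left]
  rw [← spectralNorm_mul_coisometry hcoisometry, Matrix.mul_assoc, h.range_eq, hA]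

theorem tr_kernel_eq (h : IsSplitting P U₁ U₂) (k : FormKind) :
    (k.tr U₂)ᴴ * k.tr U₂ = k.tr (1 - P) := by
  rw [← k.tr_conjTranspose, ← k.tr_mul, h.kernel_eq]

theorem tr_coisometry_right (h : IsSplitting P U₁ U₂) (k : FormKind) :
    k.tr U₂ * (k.tr U₂)ᴴ = 1 := by
  rw [← k.tr_conjTranspose, ← k.tr_mul, h.isometry_right, k.tr_one]

end IsSplitting

/-! ### Solutions of bounded spectral norm -/

section

variable [DecidableEq l] [DecidableEq m] [DecidableEq n] [DecidableEq p] {k : FormKind} {ε : ℤ}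
  {X N : Matrix n p 𝕜} {H G : Matrix n n 𝕜} {U₁ : Matrix n l 𝕜} {U₂ : Matrix n m 𝕜} {μ : ℝ}

theorem mem_prototypeSolutions_iff_exists_corner (hε : ε * ε = 1)
    (hU : IsSplitting (X * pinv X) U₁ U₂) (hH : H ∈ prototypeSolutions k ε X N) :
    G ∈ prototypeSolutions k ε X N ↔
      ∃ x : Matrix m m 𝕜, x ∈ prototype k ε ∧
        G = solMap k ε X N + (k.tr U₂)ᴴ * x * U₂ᴴ := by
  rw [mem_solutionSet_prototype_iff hε hH, ← hU.tr_kernel_eq, ← hU.kernel_eq]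
  constructor
  · rintro ⟨Z, hZ, rfl⟩
    exact ⟨k.tr U₂ * Z * U₂, tr_mul_mul_mem_prototype hZ U₂, by simp only [Matrix.mul_assoc]⟩
  · rintro ⟨x, hx, rfl⟩
    refine ⟨(k.tr U₂)ᴴ * x * U₂ᴴ, ?_, ?_⟩
    · rw [← k.tr_conjTranspose]
      exact tr_mul_mul_mem_prototype hx U₂ᴴ
    · calc solMap k ε X N + (k.tr U₂)ᴴ * x * U₂ᴴ
          = solMap k ε X N +
            (k.tr U₂)ᴴ * (k.tr U₂ * (k.tr U₂)ᴴ) * x * (U₂ᴴ * U₂) * U₂ᴴ := by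
            rw [hU.tr_coisometry_right, hU.isometry_right, Matrix.mul_one, Matrix.mul_one]
        _ = _ := by simp only [Matrix.mul_assoc]

theorem corner_solMap (hε : ε * ε = 1) (hU : IsSplitting (X * pinv X) U₁ U₂)
    (hH : H ∈ prototypeSolutions k ε X N) : k.tr U₂ * solMap k ε X N * U₂ = 0 := by
  have hcompress := tr_one_sub_mul_solMap_mul hε hH
  rw [← hU.tr_kernel_eq, ← hU.kernel_eq] at hcompress
  calc k.tr U₂ * solMap k ε X N * U₂
      = k.tr U₂ * (k.tr U₂)ᴴ * (k.tr U₂ * solMap k ε X N * U₂) * (U₂ᴴ * U₂) := by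
        rw [hU.tr_coisometry_right, hU.isometry_right, Matrix.one_mul, Matrix.mul_one]
    _ = k.tr U₂ * ((k.tr U₂)ᴴ * k.tr U₂ * solMap k ε X N * (U₂ * U₂ᴴ)) * U₂ := by
        simp only [Matrix.mul_assoc]
    _ = 0 := by rw [hcompress, Matrix.mul_zero, Matrix.zero_mul]

theorem corner_solMap_add (hε : ε * ε = 1) (hU : IsSplitting (X * pinv X) U₁ U₂)
    (hH : H ∈ prototypeSolutions k ε X N) (x : Matrix m m 𝕜) :
    k.tr U₂ * (solMap k ε X N + (k.tr U₂)ᴴ * x * U₂ᴴ) * U₂ = x := by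
  calc k.tr U₂ * (solMap k ε X N + (k.tr U₂)ᴴ * x * U₂ᴴ) * U₂
      = k.tr U₂ * solMap k ε X N * U₂ + k.tr U₂ * (k.tr U₂)ᴴ * x * (U₂ᴴ * U₂) := by
        simp only [Matrix.mul_add, Matrix.add_mul, Matrix.mul_assoc]
    _ = x := by
        rw [corner_solMap hε hU hH, hU.tr_coisometry_right, hU.isometry_right, zero_add,
          Matrix.one_mul, Matrix.mul_one]

theorem mul_left_of_mul_eq (hU : IsSplitting (X * pinv X) U₁ U₂)
    (hG : G * X = N) : G * U₁ = N * pinv X * U₁ := by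
  rw [← hG, Matrix.mul_assoc G, Matrix.mul_assoc G, hU.mul_left]

theorem corner_mem_prototype (hU : IsSplitting (X * pinv X) U₁ U₂)
    (hH : H ∈ prototypeSolutions k ε X N) :
    k.tr U₁ * (N * pinv X * U₁) ∈ prototype k ε := by
  rw [← mul_left_of_mul_eq hU hH.2, ← Matrix.mul_assoc]
  exact tr_mul_mul_mem_prototype hH.1 U₁

theorem spectralNorm_eq_fromBlocks_of_mem (hε : ε * ε = 1)
    (hU : IsSplitting (X * pinv X) U₁ U₂)
    (hG : G ∈ prototypeSolutions k ε X N) :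
    spectralNorm G = spectralNorm (fromBlocks (k.tr U₁ * (N * pinv X * U₁))
      (ε • k.tr (k.tr U₂ * (N * pinv X * U₁))) (k.tr U₂ * (N * pinv X * U₁))
      (k.tr U₂ * G * U₂)) := by
  have hadjoint : ε • k.tr (k.tr U₂ * (G * U₁)) = k.tr U₁ * (G * U₂) := by
    rw [k.tr_mul, k.tr_mul, k.tr_tr, Matrix.mul_assoc, ← Matrix.mul_smul, ← Matrix.smul_mul,
      zsmul_tr_eq_of_mem_prototype hε hG.1]
  rw [← hU.spectralNorm_fromBlocks k G, ← mul_left_of_mul_eq hU hG.2, hadjoint]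
  simp only [Matrix.mul_assoc]

theorem mem_prototypeSolutions_and_spectralNorm_le_iff (hε : ε * ε = 1)
    (hU : IsSplitting (X * pinv X) U₁ U₂) (hH : H ∈ prototypeSolutions k ε X N)
    (hμ : spectralNorm (N * pinv X) ≤ μ) {a : Matrix l l 𝕜} {K : Matrix m l 𝕜}
    (ha : a = k.tr U₁ * (N * pinv X * U₁))
    (hK : K = k.tr U₂ * (N * pinv X * U₁) * pinv (defect μ a)) :
    G ∈ prototypeSolutions k ε X N ∧ spectralNorm G ≤ μ ↔
      ∃ Z : Matrix m m 𝕜, Z ∈ prototype k ε ∧ spectralNorm Z ≤ 1 ∧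
        G = solMap k ε X N + (k.tr U₂)ᴴ * (-(ε • (K * aᴴ * k.tr K))
          + (μ : 𝕜) • (defect 1 Kᴴ * Z * k.tr (defect 1 Kᴴ))) * U₂ᴴ := by
  have ha_mem : a ∈ prototype k ε := ha ▸ corner_mem_prototype hU hH
  have hcol : spectralNorm (fromRows a (k.tr U₂ * (N * pinv X * U₁))) ≤ μ := by
    rwa [ha, hU.spectralNorm_fromRows, hU.spectralNorm_mul_left]
    rw [← Matrix.mul_assoc, Matrix.mul_assoc N, Matrix.mul_assoc N, pinv_mul_mul_pinv]
  have hcriterion := structured_spectralNorm_fromBlocks_le_iff hε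
    ((spectralNorm_nonneg _).trans hμ) ha_mem hcol hK
  have hnorm (hG : G ∈ prototypeSolutions k ε X N) := spectralNorm_eq_fromBlocks_of_mem hε hU hG
  rw [← ha] at hnorm
  constructor
  · rintro ⟨hG, hle⟩
    obtain ⟨x, hx, rfl⟩ := (mem_prototypeSolutions_iff_exists_corner hε hU hH).1 hG
    rw [hnorm hG, corner_solMap_add hε hU hH] at hle
    obtain ⟨Z, hZ, hZ1, rfl⟩ := (hcriterion x).1 ⟨hx, hle⟩
    exact ⟨Z, hZ, hZ1, rfl⟩
  · rintro ⟨Z, hZ, hZ1, rfl⟩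
    obtain ⟨hx, hle⟩ := (hcriterion _).2 ⟨Z, hZ, hZ1, rfl⟩
    have hG := (mem_prototypeSolutions_iff_exists_corner hε hU hH).2 ⟨_, hx, rfl⟩
    refine ⟨hG, ?_⟩
    rwa [hnorm hG, corner_solMap_add hε hU hH]

end

/-! ### The splitting given by a singular value decomposition -/

theorem IsMoorePenrose.unitary_mul_mul_unitary [DecidableEq m] [DecidableEq n] {X : Matrix m n 𝕜}
    {Y : Matrix n m 𝕜} (h : IsMoorePenrose X Y) {U : Matrix m m 𝕜} {V : Matrix n n 𝕜}
    (hU : U ∈ unitaryGroup m 𝕜) (hV : V ∈ unitaryGroup n 𝕜) :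
    IsMoorePenrose (U * X * Vᴴ) (V * Y * Uᴴ) := by
  have hUU : Uᴴ * U = 1 := mem_unitaryGroup_iff'.1 hU
  have hVV : Vᴴ * V = 1 := mem_unitaryGroup_iff'.1 hV
  have hleft : U * X * Vᴴ * (V * Y * Uᴴ) = U * (X * Y) * Uᴴ := by
    rw [Matrix.mul_assoc V, Matrix.mul_assoc (U * X), ← Matrix.mul_assoc Vᴴ, hVV, Matrix.one_mul]
    simp only [Matrix.mul_assoc]
  have hright : V * Y * Uᴴ * (U * X * Vᴴ) = V * (Y * X) * Vᴴ := by
    rw [Matrix.mul_assoc U, Matrix.mul_assoc (V * Y), ← Matrix.mul_assoc Uᴴ, hUU, Matrix.one_mul]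
    simp only [Matrix.mul_assoc]
  refine ⟨?_, ?_, ?_, ?_⟩
  · rw [hleft, Matrix.mul_assoc U X, Matrix.mul_assoc _ Uᴴ, ← Matrix.mul_assoc Uᴴ, hUU,
      Matrix.one_mul, ← Matrix.mul_assoc, Matrix.mul_assoc U, h.mul_mul_self, Matrix.mul_assoc]
  · rw [hright, Matrix.mul_assoc V Y, Matrix.mul_assoc _ Vᴴ, ← Matrix.mul_assoc Vᴴ, hVV,
      Matrix.one_mul, ← Matrix.mul_assoc, Matrix.mul_assoc V, h.self_mul_mul, Matrix.mul_assoc]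
  · rw [hleft]
    exact isHermitian_mul_mul_conjTranspose U h.left_herm
  · rw [hright]
    exact isHermitian_mul_mul_conjTranspose V h.right_herm

theorem rank_mul_pinv [DecidableEq n] (X : Matrix m n 𝕜) : (X * pinv X).rank = X.rank := by
  refine (rank_mul_le_left X (pinv X)).antisymm ?_
  simpa only [mul_pinv_mul_self] using rank_mul_le_left (X * pinv X) X

/-- The rectangular diagonal matrix with diagonal entries `d 0, d 1, …`, as it occurs in a singular
value decomposition. -/
def rectDiagonal (n p : ℕ) (d : ℕ → 𝕜) : Matrix (Fin n) (Fin p) 𝕜 :=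
  of fun i j => if (i : ℕ) = (j : ℕ) then d i else 0

theorem rectDiagonal_congr {n p : ℕ} {d e : ℕ → 𝕜} (h : ∀ i, i < n → i < p → d i = e i) :
    rectDiagonal n p d = rectDiagonal n p e := by
  ext i j
  rw [rectDiagonal, rectDiagonal, of_apply, of_apply]
  split_ifs with hij
  · exact h i i.2 (hij ▸ j.2)
  · rfl

theorem rectDiagonal_eq_diagonal (n : ℕ) (d : ℕ → 𝕜) :
    rectDiagonal n n d = diagonal fun i : Fin n => d i := by
  ext i j
  rw [rectDiagonal, of_apply, diagonal_apply]
  simp only [Fin.ext_iff]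

theorem rectDiagonal_mul (l m n : ℕ) (d e : ℕ → 𝕜) :
    rectDiagonal l m d * rectDiagonal m n e =
      rectDiagonal l n fun i => if i < m then d i * e i else 0 := by
  ext i j
  simp only [rectDiagonal, mul_apply, of_apply, ite_mul, zero_mul]
  by_cases hi : (i : ℕ) < m
  · rw [Finset.sum_eq_single_of_mem ⟨i, hi⟩ (Finset.mem_univ _)
      fun b _ hb => if_neg fun h => hb (Fin.ext h.symm), if_pos rfl, if_pos hi, mul_ite, mul_zero]
  · rw [Finset.sum_eq_zero fun b _ => if_neg (ne_of_gt ((not_lt.1 hi).trans_lt' b.2)), if_neg hi,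
      ite_self]

theorem isMoorePenrose_rectDiagonal (n p : ℕ) (d : ℕ → 𝕜) :
    IsMoorePenrose (rectDiagonal n p d) (rectDiagonal p n fun i => (d i)⁻¹) := by
  have hherm (n p : ℕ) (d : ℕ → 𝕜) :
      (rectDiagonal n p d * rectDiagonal p n fun i => (d i)⁻¹ : Matrix _ _ 𝕜).IsHermitian := by
    rw [rectDiagonal_mul, rectDiagonal_eq_diagonal, isHermitian_diagonal_iff]
    intro i
    rcases eq_or_ne (d i) 0 with hi | hi <;> simp [hi, apply_ite, IsSelfAdjoint]
  refine ⟨?_, ?_, hherm n p d, ?_⟩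
  · rw [rectDiagonal_mul, rectDiagonal_mul]
    exact rectDiagonal_congr fun i hn hp => by
      rw [if_pos hn, if_pos hp, mul_inv_mul_cancel]
  · rw [rectDiagonal_mul, rectDiagonal_mul]
    exact rectDiagonal_congr fun i hp hn => by
      rw [if_pos hp, if_pos hn]
      simpa only [inv_inv] using mul_inv_mul_cancel (d i)⁻¹
  · have hright := hherm p n fun i => (d i)⁻¹
    simp only [inv_inv] at hright
    exact hright

theorem lt_card_iff_mem_of_isLowerSet {n : ℕ} {T : Finset (Fin n)}
    (hT : IsLowerSet (T : Set (Fin n))) (i : Fin n) : (i : ℕ) < T.card ↔ i ∈ T := by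
  constructor
  · intro hi
    by_contra hiT
    have hsub : T ⊆ Finset.Iio i := fun j hj =>
      Finset.mem_Iio.2 (not_le.1 fun hij => hiT (hT hij hj))
    exact hi.not_ge (Fin.card_Iio i ▸ Finset.card_le_card hsub)
  · intro hiT
    have hsub : Finset.Iic i ⊆ T := fun j hj => hT (Finset.mem_Iic.1 hj) hiT
    rw [← Nat.succ_le_iff, Nat.succ_eq_add_one, ← Fin.card_Iic]
    exact Finset.card_le_card hsub

namespace IsSVD

variable {n p : ℕ} {X : Matrix (Fin n) (Fin p) 𝕜} {U : Matrix (Fin n) (Fin n) 𝕜} {s : ℕ → ℝ}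
  {V : Matrix (Fin p) (Fin p) 𝕜}

theorem mul_pinv_eq (h : IsSVD X U s V) :
    X * pinv X = U * diagonal (fun i : Fin n => if (i : ℕ) < p ∧ s i ≠ 0 then 1 else 0) * Uᴴ := by
  have hX : X = U * rectDiagonal n p (fun i => (s i : 𝕜)) * Vᴴ := h.eq
  have hpinv := (isMoorePenrose_rectDiagonal n p fun i => (s i : 𝕜)).unitary_mul_mul_unitary
    h.unitary_left h.unitary_right
  rw [← hX] at hpinv
  have hVV : Vᴴ * V = 1 := mem_unitaryGroup_iff'.1 h.unitary_right
  rw [(pinv_spec X).unique hpinv]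
  nth_rewrite 1 [hX]
  rw [Matrix.mul_assoc V, Matrix.mul_assoc (U * _), ← Matrix.mul_assoc Vᴴ, hVV, Matrix.one_mul,
    ← Matrix.mul_assoc, Matrix.mul_assoc U, rectDiagonal_mul, rectDiagonal_eq_diagonal]
  congr 3 with i
  by_cases hs : s i = 0 <;> simp [hs]

theorem lt_rank_iff (h : IsSVD X U s V) (i : Fin n) :
    (i : ℕ) < X.rank ↔ (i : ℕ) < p ∧ s i ≠ 0 := by
  have hdet : IsUnit U.det := isUnit_det_of_left_inverse (mem_unitaryGroup_iff'.1 h.unitary_left)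
  have hdet' : IsUnit Uᴴ.det := isUnit_det_of_left_inverse (mem_unitaryGroup_iff.1 h.unitary_left)
  have hrank : X.rank = (Finset.univ.filter fun i : Fin n => (i : ℕ) < p ∧ s i ≠ 0).card := by
    rw [← rank_mul_pinv, h.mul_pinv_eq, rank_mul_eq_left_of_isUnit_det _ _ hdet',
      rank_mul_eq_right_of_isUnit_det _ _ hdet, rank_diagonal, Fintype.card_subtype]
    simp only [ne_eq, ite_eq_right_iff, one_ne_zero, imp_false, not_not]
  rw [hrank, lt_card_iff_mem_of_isLowerSet, Finset.mem_filter_univ]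
  intro j i hij hj
  rw [Finset.mem_coe, Finset.mem_filter_univ] at hj ⊢
  have hpos : 0 < s j := (h.nonneg j).lt_of_ne' hj.2
  exact ⟨lt_of_le_of_lt hij hj.1, (hpos.trans_le (h.anti hij)).ne'⟩

theorem isSplitting (h : IsSVD X U s V) :
    IsSplitting (X * pinv X) (leftCols U X.rank) (rightCols U X.rank) := by
  rw [h.mul_pinv_eq]
  simp only [← h.lt_rank_iff]
  exact isSplitting_of_unitary h.unitary_left fun i => not_lt.symm

end IsSVD

/-! ### Optimal solutions in the prototype classes -/

section

variable {ν : Matrix n n 𝕜 → ℝ} {S : Set (Matrix n n 𝕜)} {X B : Matrix n p 𝕜}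

omit [Fintype p] in
theorem minNorm_eq_of_isLeast {G : Matrix n n 𝕜} (hG : G ∈ solutionSet S X B)
    (hle : ∀ A ∈ solutionSet S X B, ν G ≤ ν A) : minNorm ν S X B = ν G :=
  IsLeast.csInf_eq ⟨Set.mem_image_of_mem ν hG, Set.forall_mem_image.2 hle⟩

end

section

variable [DecidableEq n] [DecidableEq p] {k : FormKind} {ε : ℤ} {X N : Matrix n p 𝕜}
  {H G : Matrix n n 𝕜}

omit [DecidableEq n] in
theorem isOptimal_frobeniusNorm_prototype_iff (hε : ε * ε = 1)
    (hH : H ∈ prototypeSolutions k ε X N) :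
    IsOptimal frobeniusNorm (prototype k ε : Submodule ℝ (Matrix n n 𝕜)) X N G ↔
      G = solMap k ε X N := by
  classical
  have hsol := solMap_mem_solutionSet hε hH
  have hmin : minNorm frobeniusNorm (prototype k ε : Submodule ℝ (Matrix n n 𝕜)) X N =
      frobeniusNorm (solMap k ε X N) := by
    refine minNorm_eq_of_isLeast hsol fun A hA => ?_
    refine le_of_sq_le_sq ?_ (frobeniusNorm_nonneg A)
    rw [frobeniusNorm_solution_sq_eq_add hε hA]
    exact le_add_of_nonneg_right (sq_nonneg _)
  constructor
  · rintro ⟨hG, hopt⟩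
    have hpythagoras := frobeniusNorm_solution_sq_eq_add hε hG
    rw [hopt, hmin, left_eq_add, sq_eq_zero_iff, frobeniusNorm_eq_zero] at hpythagoras
    exact sub_eq_zero.1 hpythagoras
  · rintro rfl
    exact ⟨hsol, hmin.symm⟩

theorem spectralNorm_mul_pinv_le (hG : G * X = N) : spectralNorm (N * pinv X) ≤ spectralNorm G := by
  rw [← hG, Matrix.mul_assoc]
  exact (spectralNorm_mul_le _ _).trans (mul_le_of_le_one_right (spectralNorm_nonneg G)
    (spectralNorm_le_one_of_isStarProjection (isStarProjection_mul_pinv X)))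

theorem minNorm_spectralNorm_univ (hG : G * X = N) :
    minNorm spectralNorm Set.univ X N = spectralNorm (N * pinv X) := by
  refine minNorm_eq_of_isLeast ⟨Set.mem_univ _, ?_⟩ fun A hA => spectralNorm_mul_pinv_le hA.2
  rw [← hG, Matrix.mul_assoc, Matrix.mul_assoc, ← Matrix.mul_assoc X, mul_pinv_mul_self]

theorem minNorm_spectralNorm_prototype (hε : ε * ε = 1) (hH : H ∈ prototypeSolutions k ε X N) :
    minNorm spectralNorm (prototype k ε : Submodule ℝ (Matrix n n 𝕜)) X N =
      spectralNorm (N * pinv X) := by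
  obtain ⟨q, _, U₁, U₂, hU⟩ := exists_isSplitting (isStarProjection_mul_pinv X)
  obtain ⟨hG, hle⟩ := (mem_prototypeSolutions_and_spectralNorm_le_iff hε hU hH le_rfl rfl rfl).2
    ⟨0, zero_mem _, spectralNorm_le_one_iff.2 (by simp), rfl⟩
  have hattained := hle.antisymm (spectralNorm_mul_pinv_le hG.2)
  rw [← hattained]
  exact minNorm_eq_of_isLeast hG fun A hA => hattained.trans_le (spectralNorm_mul_pinv_le hA.2)

/-- The optimal solution for the spectral norm belonging to a contraction `Z`, in the four
prototype classes at once: the columns of `U₁` and `U₂` span the range of `X` and its orthogonal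
complement, and `(k.tr Y)ᴴ` is the entrywise conjugate of `Y` for a bilinear form and `Y` itself for
a sesquilinear one. -/
def optimalFamily [DecidableEq l] [DecidableEq m] (k : FormKind) (ε : ℤ) (X N : Matrix n p 𝕜)
    (U₁ : Matrix n l 𝕜) (U₂ : Matrix n m 𝕜) (Z : Matrix m m 𝕜) : Matrix n n 𝕜 :=
  let Y := N * pinv X
  let Q := 1 - X * pinv X
  let μ : 𝕜 := ((spectralNorm Y : ℝ) : 𝕜)
  let K := Y * U₁ * psdInvSqrt (μ ^ 2 • 1 - ε • (U₁ᴴ * (k.tr Y)ᴴ * Y * U₁))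
  solMap k ε X N - k.tr Q * K * U₁ᴴ * (k.tr (Y * U₁))ᴴ * k.tr K * Q +
    μ • ((k.tr U₂)ᴴ * psdSqrt (1 - k.tr U₂ * K * Kᴴ * (k.tr U₂)ᴴ) * Z *
      psdSqrt (1 - U₂ᴴ * (k.tr K)ᴴ * k.tr K * U₂) * U₂ᴴ)

variable [DecidableEq l] [DecidableEq m] {U₁ : Matrix n l 𝕜} {U₂ : Matrix n m 𝕜}

theorem conjTranspose_mul_tr_conjTranspose (hU : IsSplitting (X * pinv X) U₁ U₂)
    (hH : H ∈ prototypeSolutions k ε X N) :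
    U₁ᴴ * (k.tr (N * pinv X * U₁))ᴴ = ε • (k.tr U₁ * (N * pinv X * U₁))ᴴ := by
  rw [← conjTranspose_mul, ← conjTranspose_zsmul, ← mem_prototype.1 (corner_mem_prototype hU hH),
    k.tr_mul (k.tr U₁), k.tr_tr]

theorem zsmul_conjTranspose_mul_tr_mul (hε : ε * ε = 1) (hU : IsSplitting (X * pinv X) U₁ U₂)
    (hH : H ∈ prototypeSolutions k ε X N) :
    ε • (U₁ᴴ * (k.tr (N * pinv X))ᴴ * (N * pinv X) * U₁) =
      (k.tr U₁ * (N * pinv X * U₁))ᴴ * (k.tr U₁ * (N * pinv X * U₁)) := by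
  have hY : (k.tr (N * pinv X))ᴴ = (k.tr (N * pinv X * U₁))ᴴ * k.tr U₁ := by
    have hP : N * pinv X * U₁ * U₁ᴴ = N * pinv X := by
      rw [Matrix.mul_assoc _ U₁, hU.range_eq, Matrix.mul_assoc, ← Matrix.mul_assoc (pinv X),
        pinv_mul_mul_pinv]
    nth_rewrite 1 [← hP]
    rw [k.tr_mul, conjTranspose_mul, k.tr_conjTranspose, conjTranspose_conjTranspose]
  rw [hY, ← Matrix.mul_assoc U₁ᴴ, conjTranspose_mul_tr_conjTranspose hU hH, Matrix.mul_assoc,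
    Matrix.mul_assoc, Matrix.smul_mul, smul_smul, hε, one_smul]

theorem optimalFamily_eq (hε : ε * ε = 1) (hU : IsSplitting (X * pinv X) U₁ U₂)
    (hH : H ∈ prototypeSolutions k ε X N) {a : Matrix l l 𝕜} {K : Matrix m l 𝕜}
    (ha : a = k.tr U₁ * (N * pinv X * U₁))
    (hK : K = k.tr U₂ * (N * pinv X * U₁) * pinv (defect (spectralNorm (N * pinv X)) a))
    (Z : Matrix m m 𝕜) :
    optimalFamily k ε X N U₁ U₂ Z = solMap k ε X N + (k.tr U₂)ᴴ * (-(ε • (K * aᴴ * k.tr K)) +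
      ((spectralNorm (N * pinv X) : ℝ) : 𝕜) • (defect 1 Kᴴ * Z * k.tr (defect 1 Kᴴ))) * U₂ᴴ := by
  have hmiddle := conjTranspose_mul_tr_conjTranspose hU hH
  have hcore := zsmul_conjTranspose_mul_tr_mul hε hU hH
  rw [← ha] at hmiddle hcore
  obtain ⟨L, hL⟩ : ∃ L, L = N * pinv X * U₁ * pinv (defect (spectralNorm (N * pinv X)) a) :=
    ⟨_, rfl⟩
  have hKL : K = k.tr U₂ * L := by rw [hK, hL, Matrix.mul_assoc]
  have htrK : k.tr K = k.tr L * U₂ := by rw [hKL, k.tr_mul, k.tr_tr]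
  have hleft : psdSqrt (1 - k.tr U₂ * L * Lᴴ * (k.tr U₂)ᴴ) = defect 1 Kᴴ := by
    rw [defect, hKL, conjTranspose_conjTranspose, conjTranspose_mul, RCLike.ofReal_one, one_pow,
      one_smul, Matrix.mul_assoc]
  have hright : psdSqrt (1 - U₂ᴴ * (k.tr L)ᴴ * k.tr L * U₂) = k.tr (defect 1 Kᴴ) := by
    rw [k.tr_defect, k.tr_conjTranspose, conjTranspose_conjTranspose, htrK, defect,
      conjTranspose_mul, RCLike.ofReal_one, one_pow, one_smul, Matrix.mul_assoc _ (k.tr L)]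
  have hcorrection : (k.tr U₂)ᴴ * k.tr U₂ * L * U₁ᴴ * (k.tr (N * pinv X * U₁))ᴴ * k.tr L *
      (U₂ * U₂ᴴ) = (k.tr U₂)ᴴ * (ε • (K * aᴴ * k.tr K)) * U₂ᴴ := by
    rw [Matrix.mul_assoc (_ * L) U₁ᴴ, hmiddle, htrK, hKL]
    simp only [Matrix.mul_smul, Matrix.smul_mul, Matrix.mul_assoc]
  simp only [optimalFamily]
  rw [hcore, ← hU.tr_kernel_eq, ← hU.kernel_eq, psdInvSqrt, ← defect, ← hL, hcorrection, hleft,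
    hright]
  simp only [Matrix.mul_add, Matrix.add_mul, Matrix.mul_neg, Matrix.neg_mul, Matrix.mul_smul,
    Matrix.smul_mul, Matrix.mul_assoc]
  rw [sub_eq_add_neg, add_assoc]

theorem isOptimal_spectralNorm_prototype_iff (hε : ε * ε = 1)
    (hU : IsSplitting (X * pinv X) U₁ U₂) (hH : H ∈ prototypeSolutions k ε X N) :
    IsOptimal spectralNorm (prototype k ε : Submodule ℝ (Matrix n n 𝕜)) X N G ↔
      ∃ Z : Matrix m m 𝕜, Z ∈ prototype k ε ∧ spectralNorm Z ≤ 1 ∧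
        G = optimalFamily k ε X N U₁ U₂ Z := by
  simp only [optimalFamily_eq hε hU hH rfl rfl]
  rw [← mem_prototypeSolutions_and_spectralNorm_le_iff hε hU hH le_rfl rfl rfl, IsOptimal,
    minNorm_spectralNorm_prototype hε hH]
  exact and_congr_right fun hG => ⟨le_of_eq,
    fun hle => hle.antisymm (spectralNorm_mul_pinv_le hG.2)⟩

end

/-! ### Transfer from the prototype classes -/

section

variable {n p : Type*} [Fintype n] {ν : Matrix n n 𝕜 → ℝ} {S T : Set (Matrix n n 𝕜)}
  {X B C : Matrix n p 𝕜} {f : Matrix n n 𝕜 → Matrix n n 𝕜}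

theorem minNorm_eq_of_surjective (hf : f.Surjective) (hν : ∀ A, ν (f A) = ν A)
    (hST : ∀ A, A ∈ solutionSet S X B ↔ f A ∈ solutionSet T X C) :
    minNorm ν S X B = minNorm ν T X C := by
  have hpreimage : solutionSet S X B = f ⁻¹' solutionSet T X C := Set.ext hST
  have hcomp : ν ∘ f = ν := funext hν
  rw [minNorm, minNorm, hpreimage, ← hcomp, Set.image_comp, hcomp, Set.image_preimage_eq _ hf]

theorem isOptimal_iff_of_surjective (hf : f.Surjective) (hν : ∀ A, ν (f A) = ν A)
    (hST : ∀ A, A ∈ solutionSet S X B ↔ f A ∈ solutionSet T X C) {A : Matrix n n 𝕜} :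
    IsOptimal ν S X B A ↔ IsOptimal ν T X C (f A) := by
  rw [IsOptimal, IsOptimal, hST, hν, minNorm_eq_of_surjective hf hν hST]

end

section

variable [DecidableEq n] {M A : Matrix n n 𝕜} {S T : Set (Matrix n n 𝕜)} {X B : Matrix n p 𝕜}
  {ν : Matrix n n 𝕜 → ℝ}

theorem isUnit_det_of_mem_unitaryGroup (hM : M ∈ unitaryGroup n 𝕜) : IsUnit M.det :=
  UnitaryGroup.det_isUnit ⟨M, hM⟩

theorem eq_inv_mul_iff {n m : Type*} [Fintype n] [DecidableEq n] {M : Matrix n n 𝕜}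
    (hM : IsUnit M.det) {A G : Matrix n m 𝕜} : A = M⁻¹ * G ↔ M * A = G :=
  ⟨by rintro rfl; exact mul_nonsing_inv_cancel_left M G hM,
    by rintro rfl; exact (nonsing_inv_mul_cancel_left M A hM).symm⟩

theorem mul_mem_leftMul_iff (hM : IsUnit M.det) : M * A ∈ leftMul M S ↔ A ∈ S :=
  Function.Injective.mem_set_image fun _ _ h => (eq_inv_mul_iff hM).2 h |>.trans
    (nonsing_inv_mul_cancel_left M _ hM)

theorem leftMul_preimage (hM : IsUnit M.det) : leftMul M {G | M * G ∈ T} = T :=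
  Set.image_preimage_eq T fun G => ⟨M⁻¹ * G, mul_nonsing_inv_cancel_left M G hM⟩

omit [Fintype p] in
theorem mem_solutionSet_iff_mul_mem (hM : IsUnit M.det) :
    A ∈ solutionSet S X B ↔ M * A ∈ solutionSet (leftMul M S) X (M * B) := by
  refine and_congr (mul_mem_leftMul_iff hM).symm ?_
  rw [Matrix.mul_assoc, ← eq_inv_mul_iff hM, nonsing_inv_mul_cancel_left M B hM]

omit [Fintype p] in
theorem isOptimal_iff_mul_left (hM : IsUnit M.det) (hν : ∀ A, ν (M * A) = ν A) :
    IsOptimal ν S X B A ↔ IsOptimal ν (leftMul M S) X (M * B) (M * A) :=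
  isOptimal_iff_of_surjective (fun G => ⟨M⁻¹ * G, mul_nonsing_inv_cancel_left M G hM⟩) hν
    fun _ => mem_solutionSet_iff_mul_mem hM

omit [Fintype p] in
theorem minNorm_eq_mul_left (hM : IsUnit M.det) (hν : ∀ A, ν (M * A) = ν A) :
    minNorm ν S X B = minNorm ν (leftMul M S) X (M * B) :=
  minNorm_eq_of_surjective (fun G => ⟨M⁻¹ * G, mul_nonsing_inv_cancel_left M G hM⟩) hν
    fun _ => mem_solutionSet_iff_mul_mem hM

omit [Fintype p] in
theorem exists_mem_prototypeSolutions {k : FormKind} {ε : ℤ} (hM : IsUnit M.det)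
    (hS : leftMul M S = (prototype k ε : Submodule ℝ (Matrix n n 𝕜)))
    (hne : (solutionSet S X B).Nonempty) : ∃ H, H ∈ prototypeSolutions k ε X (M * B) := by
  obtain ⟨A, hA⟩ := hne
  rw [mem_solutionSet_iff_mul_mem hM, hS] at hA
  exact ⟨M * A, hA⟩

theorem spectralNorm_unitary_mul [DecidableEq p] (hM : M ∈ unitaryGroup n 𝕜) (A : Matrix n p 𝕜) :
    spectralNorm (M * A) = spectralNorm A :=
  spectralNorm_isometry_mul (mem_unitaryGroup_iff'.1 hM) A

theorem frobeniusNorm_unitary_mul (hM : M ∈ unitaryGroup n 𝕜) (A : Matrix n p 𝕜) :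
    frobeniusNorm (M * A) = frobeniusNorm A :=
  frobeniusNorm_isometry_mul (mem_unitaryGroup_iff'.1 hM) A

end

section

variable [DecidableEq n] [DecidableEq p] {M A : Matrix n n 𝕜} {S : Set (Matrix n n 𝕜)}
  {X B : Matrix n p 𝕜} {k : FormKind} {ε : ℤ}

theorem mem_solutionSet_iff (hε : ε * ε = 1) (hM : IsUnit M.det)
    (hS : leftMul M S = (prototype k ε : Submodule ℝ (Matrix n n 𝕜)))
    (hne : (solutionSet S X B).Nonempty) :
    A ∈ solutionSet S X B ↔ ∃ Z ∈ leftMul M S, A = M⁻¹ * solMap k ε X (M * B) +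
      M⁻¹ * k.tr (1 - X * pinv X) * Z * (1 - X * pinv X) := by
  obtain ⟨H, hH⟩ := exists_mem_prototypeSolutions hM hS hne
  have hiff := mem_solutionSet_prototype_iff hε hH (G := M * A)
  rw [mem_solutionSet_iff_mul_mem hM, hS, hiff]
  simp only [← eq_inv_mul_iff hM, Matrix.mul_add, Matrix.mul_assoc, SetLike.mem_coe]

theorem isOptimal_frobeniusNorm_iff (hε : ε * ε = 1) (hM : M ∈ unitaryGroup n 𝕜)
    (hS : leftMul M S = (prototype k ε : Submodule ℝ (Matrix n n 𝕜)))
    (hne : (solutionSet S X B).Nonempty) :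
    IsOptimal frobeniusNorm S X B A ↔ A = M⁻¹ * solMap k ε X (M * B) := by
  have hdet := isUnit_det_of_mem_unitaryGroup hM
  obtain ⟨H, hH⟩ := exists_mem_prototypeSolutions hdet hS hne
  rw [isOptimal_iff_mul_left hdet (frobeniusNorm_unitary_mul hM), hS,
    isOptimal_frobeniusNorm_prototype_iff hε hH, eq_inv_mul_iff hdet]

omit [DecidableEq n] in
theorem trace_mul_conjTranspose_mul_tr (Y : Matrix n n 𝕜) :
    trace (Y * Yᴴ * k.tr (X * pinv X)) = ((frobeniusNorm (k.tr (X * pinv X) * Y) ^ 2 : ℝ) : 𝕜) :=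
  trace_mul_conjTranspose_mul_of_isStarProjection
    (k.isStarProjection_tr (isStarProjection_mul_pinv X)) Y

theorem frobeniusNorm_inv_mul_solMap (hε : ε * ε = 1) (hM : M ∈ unitaryGroup n 𝕜)
    (hS : leftMul M S = (prototype k ε : Submodule ℝ (Matrix n n 𝕜)))
    (hne : (solutionSet S X B).Nonempty) :
    frobeniusNorm (M⁻¹ * solMap k ε X (M * B)) = √(2 * frobeniusNorm (B * pinv X) ^ 2 -
      RCLike.re (trace (M * B * pinv X * (M * B * pinv X)ᴴ * k.tr (X * pinv X)))) := by
  have hdet := isUnit_det_of_mem_unitaryGroup hM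
  obtain ⟨H, hH⟩ := exists_mem_prototypeSolutions hdet hS hne
  rw [← frobeniusNorm_unitary_mul hM, mul_nonsing_inv_cancel_left M _ hdet,
    ← frobeniusNorm_unitary_mul hM (B * pinv X), ← Matrix.mul_assoc M,
    trace_mul_conjTranspose_mul_tr, RCLike.ofReal_re, ← frobeniusNorm_solMap_sq hε hH,
    Real.sqrt_sq (frobeniusNorm_nonneg _)]

theorem minNorm_spectralNorm (hε : ε * ε = 1) (hM : M ∈ unitaryGroup n 𝕜)
    (hS : leftMul M S = (prototype k ε : Submodule ℝ (Matrix n n 𝕜)))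
    (hne : (solutionSet S X B).Nonempty) :
    minNorm spectralNorm S X B = spectralNorm (B * pinv X) := by
  have hdet := isUnit_det_of_mem_unitaryGroup hM
  obtain ⟨H, hH⟩ := exists_mem_prototypeSolutions hdet hS hne
  rw [minNorm_eq_mul_left hdet (spectralNorm_unitary_mul hM), hS,
    minNorm_spectralNorm_prototype hε hH, Matrix.mul_assoc, spectralNorm_unitary_mul hM]

theorem isOptimal_spectralNorm_iff [DecidableEq l] [DecidableEq m] {U₁ : Matrix n l 𝕜}
    {U₂ : Matrix n m 𝕜} (hε : ε * ε = 1) (hM : M ∈ unitaryGroup n 𝕜)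
    (hS : leftMul M S = (prototype k ε : Submodule ℝ (Matrix n n 𝕜)))
    (hne : (solutionSet S X B).Nonempty) (hU : IsSplitting (X * pinv X) U₁ U₂) :
    IsOptimal spectralNorm S X B A ↔ ∃ Z : Matrix m m 𝕜, Z ∈ prototype k ε ∧
      spectralNorm Z ≤ 1 ∧ A = M⁻¹ * optimalFamily k ε X (M * B) U₁ U₂ Z := by
  have hdet := isUnit_det_of_mem_unitaryGroup hM
  obtain ⟨H, hH⟩ := exists_mem_prototypeSolutions hdet hS hne
  rw [isOptimal_iff_mul_left hdet (spectralNorm_unitary_mul hM), hS,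
    isOptimal_spectralNorm_prototype_iff hε hU hH]
  simp only [eq_inv_mul_iff hdet]

end

/-! ### The families of the theorem -/

section

variable {n p : ℕ} {M : Matrix (Fin n) (Fin n) 𝕜}

theorem familyT_eq (hM : M ∈ unitaryGroup (Fin n) 𝕜) (ε : ℤ) (X B : Matrix (Fin n) (Fin p) 𝕜)
    (U : Matrix (Fin n) (Fin n) 𝕜)
    (Z : Matrix {i : Fin n // X.rank ≤ (i : ℕ)} {i : Fin n // X.rank ≤ (i : ℕ)} 𝕜) :
    familyT ε M X B U Z = M⁻¹ * optimalFamily .bilinear ε X (M * B) (leftCols U X.rank)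
      (rightCols U X.rank) Z := by
  have hconj {a b : Type} (A : Matrix a b 𝕜) : conjMat A = Aᵀᴴ := rfl
  simp only [familyT, optimalFamily, FormKind.tr, hconj, Matrix.mul_add M⁻¹, Matrix.mul_sub M⁻¹,
    Matrix.mul_assoc, spectralNorm_unitary_mul hM]

theorem familyH_eq (hM : M ∈ unitaryGroup (Fin n) 𝕜) (X B : Matrix (Fin n) (Fin p) 𝕜)
    (U : Matrix (Fin n) (Fin n) 𝕜)
    (Z : Matrix {i : Fin n // X.rank ≤ (i : ℕ)} {i : Fin n // X.rank ≤ (i : ℕ)} 𝕜) :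
    familyH M X B U Z = M⁻¹ * optimalFamily .sesquilinear 1 X (M * B) (leftCols U X.rank)
      (rightCols U X.rank) Z := by
  have hQ : (1 - X * pinv X)ᴴ = 1 - X * pinv X :=
    (isStarProjection_mul_pinv X).one_sub.isSelfAdjoint
  simp only [familyH, optimalFamily, FormKind.tr, hQ]
  generalize 1 - X * pinv X = Q
  simp only [conjTranspose_conjTranspose, one_smul, Matrix.mul_add M⁻¹, Matrix.mul_sub M⁻¹,
    Matrix.mul_assoc, spectralNorm_unitary_mul hM]

end

/-! ### Multiplication by the imaginary unit -/

section

variable {n p : Type*} [Fintype n] {M A : Matrix n n 𝕜} {S : Set (Matrix n n 𝕜)}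
  {X B : Matrix n p 𝕜}

theorem eq_neg_I_smul_iff {n : Type*} {A G : Matrix n n 𝕜} (hI : (RCLike.I : 𝕜) ≠ 0) :
    A = -(RCLike.I : 𝕜) • G ↔ (RCLike.I : 𝕜) • A = G := by
  rw [← RCLike.inv_I, eq_inv_smul_iff₀ hI]

theorem I_smul_mem_prototype_iff {n : Type*} {A : Matrix n n 𝕜} (hI : (RCLike.I : 𝕜) ≠ 0) :
    (RCLike.I : 𝕜) • A ∈ prototype .sesquilinear 1 ↔ A ∈ prototype .sesquilinear (-1) := by
  rw [mem_prototype, mem_prototype, FormKind.tr, FormKind.tr, conjTranspose_smul, RCLike.star_def,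
    RCLike.conj_I, neg_smul, ← smul_neg, one_smul, neg_one_smul, smul_right_inj hI,
    neg_eq_iff_eq_neg]

theorem mem_solutionSet_iff_I_smul_mem [DecidableEq n] (hI : (RCLike.I : 𝕜) ≠ 0)
    (hM : IsUnit M.det) (hS : leftMul M S =
      (prototype .sesquilinear (-1) : Submodule ℝ (Matrix n n 𝕜))) :
    A ∈ solutionSet S X B ↔ (RCLike.I : 𝕜) • A ∈
      solutionSet {G | M * G ∈ prototype .sesquilinear 1} X ((RCLike.I : 𝕜) • B) := by
  refine and_congr ?_ (by rw [Matrix.smul_mul, smul_right_inj hI])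
  rw [← mul_mem_leftMul_iff hM, hS, SetLike.mem_coe, ← I_smul_mem_prototype_iff hI,
    ← Matrix.mul_smul, Set.mem_ofPred_eq]

theorem isOptimal_spectralNorm_iff_I_smul [DecidableEq n] (hI : (RCLike.I : 𝕜) ≠ 0)
    (hM : IsUnit M.det) (hS : leftMul M S =
      (prototype .sesquilinear (-1) : Submodule ℝ (Matrix n n 𝕜))) :
    IsOptimal spectralNorm S X B A ↔ IsOptimal spectralNorm
      {G | M * G ∈ prototype .sesquilinear 1} X ((RCLike.I : 𝕜) • B) ((RCLike.I : 𝕜) • A) :=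
  isOptimal_iff_of_surjective (f := fun A => (RCLike.I : 𝕜) • A)
    (fun G => ⟨_, (eq_neg_I_smul_iff hI).1 rfl⟩)
    (fun A => by rw [spectralNorm_smul, RCLike.norm_I_of_ne_zero hI, one_mul])
    fun _ => mem_solutionSet_iff_I_smul_mem hI hM hS

end

/-! ### Jordan and Lie algebras -/

namespace MatrixClass

theorem carrier_eq_prototype {n : Type*} (c : MatrixClass) :
    c.carrier n 𝕜 = (prototype c.form c.sign : Submodule ℝ (Matrix n n 𝕜)) := by
  ext A
  rw [SetLike.mem_coe, mem_prototype]
  cases c <;> simp [carrier, form, sign, FormKind.tr]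

theorem sign_mul_self (c : MatrixClass) : c.sign * c.sign = 1 := by
  cases c <;> rfl

theorem exists_form_sign (k : FormKind) {ε : ℤ} (hε : ε * ε = 1) :
    ∃ c : MatrixClass, c.form = k ∧ c.sign = ε := by
  rcases mul_self_eq_one_iff.1 hε with rfl | rfl <;> cases k
  exacts [⟨sym, rfl, rfl⟩, ⟨herm, rfl, rfl⟩, ⟨skewSym, rfl, rfl⟩, ⟨skewHerm, rfl, rfl⟩]

end MatrixClass

section

variable [DecidableEq n] {M : Matrix n n 𝕜} {k : FormKind}

theorem adj_eq_zsmul_iff {δ ε : ℤ} (hδ : δ * δ = 1) (hM : IsUnit M.det) (hMδ : k.tr M = δ • M)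
    (A : Matrix n n 𝕜) : adj k M A = ε • A ↔ M * A ∈ prototype k (δ * ε) := by
  have htr : k.tr (M * A) = δ • (k.tr A * M) := by rw [k.tr_mul, hMδ, Matrix.mul_smul]
  have hinj : Function.Injective (fun G : Matrix n n 𝕜 => δ • G) :=
    Function.LeftInverse.injective (g := fun G => δ • G) fun G => by
      simp only [smul_smul, hδ, one_smul]
  rw [adj, Matrix.mul_assoc, eq_comm, eq_inv_mul_iff hM, Matrix.mul_smul, eq_comm, mem_prototype,
    htr, mul_smul]
  exact hinj.eq_iff.symm

theorem exists_leftMul_structuredSet_eq (hM : IsUnit M.det) (hMk : k.tr M = M ∨ k.tr M = -M)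
    (a : AlgebraKind) :
    ∃ c : MatrixClass, leftMul M (structuredSet k M a) = c.carrier n 𝕜 := by
  obtain ⟨δ, hδ, hMδ⟩ : ∃ δ : ℤ, δ * δ = 1 ∧ k.tr M = δ • M := by
    rcases hMk with h | h
    · exact ⟨1, rfl, by rw [h, one_smul]⟩
    · exact ⟨-1, rfl, by rw [h, neg_one_smul]⟩
  obtain ⟨ε, hε, hS⟩ : ∃ ε : ℤ, ε * ε = 1 ∧ structuredSet k M a = {A | adj k M A = ε • A} := by
    cases a
    · exact ⟨1, rfl, by simp only [structuredSet, one_smul]⟩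
    · exact ⟨-1, rfl, by simp only [structuredSet, neg_one_smul]⟩
  obtain ⟨c, rfl, hc⟩ := MatrixClass.exists_form_sign k (ε := δ * ε)
    (by rw [mul_mul_mul_comm, hδ, hε, one_mul])
  refine ⟨c, ?_⟩
  simp only [hS, adj_eq_zsmul_iff hδ hM hMδ, c.carrier_eq_prototype, hc]
  exact leftMul_preimage hM

end

end StructuredMapping

end

open StructuredMapping in
theorem theorem3p3 {𝕜 : Type*} [RCLike 𝕜] {n p : ℕ}
    (k : FormKind) (M : Matrix (Fin n) (Fin n) 𝕜)
    (hU : M ∈ Matrix.unitaryGroup (Fin n) 𝕜) (hM : k.tr M = M ∨ k.tr M = -M)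
    (a : AlgebraKind) (S : Set (Matrix (Fin n) (Fin n) 𝕜)) (hS : S = structuredSet k M a)
    (X B : Matrix (Fin n) (Fin p) 𝕜) (hne : (solutionSet S X B).Nonempty) :
    -- `M S` is one of the four prototype classes, and whichever class `c` it is:
    (∃ c : MatrixClass, leftMul M S = c.carrier (Fin n) 𝕜) ∧
    ∀ c : MatrixClass, leftMul M S = c.carrier (Fin n) 𝕜 →
      -- all solutions
      (∀ A : Matrix (Fin n) (Fin n) 𝕜, A ∈ solutionSet S X B ↔
        ∃ Z ∈ leftMul M S,
          A = M⁻¹ * solMap c.form c.sign X (M * B)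
            + M⁻¹ * c.form.tr (1 - X * pinv X) * Z * (1 - X * pinv X)) ∧
      -- (a) Frobenius norm
      (∀ A : Matrix (Fin n) (Fin n) 𝕜, IsOptimal frobeniusNorm S X B A ↔
        A = M⁻¹ * solMap c.form c.sign X (M * B)) ∧
      (frobeniusNorm (M⁻¹ * solMap c.form c.sign X (M * B)) =
        √(2 * frobeniusNorm (B * pinv X) ^ 2 -
          RCLike.re (Matrix.trace (M * B * pinv X * (M * B * pinv X).conjTranspose *
            c.form.tr (X * pinv X)))) ∧
        RCLike.im (Matrix.trace (M * B * pinv X * (M * B * pinv X).conjTranspose *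
            c.form.tr (X * pinv X))) = 0) ∧
      -- (b) spectral norm
      minNorm spectralNorm S X B = spectralNorm (B * pinv X) ∧
      minNorm spectralNorm Set.univ X B = spectralNorm (B * pinv X) ∧
      (∀ (U : Matrix (Fin n) (Fin n) 𝕜) (s : ℕ → ℝ) (V : Matrix (Fin p) (Fin p) 𝕜),
        IsSVD X U s V →
        (c = .sym ∨ c = .skewSym → ∀ A : Matrix (Fin n) (Fin n) 𝕜,
          IsOptimal spectralNorm S X B A ↔
            ∃ Z ∈ c.carrier {i : Fin n // X.rank ≤ (i : ℕ)} 𝕜,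
              spectralNorm Z ≤ 1 ∧ A = familyT c.sign M X B U Z) ∧
        (c = .herm → ∀ A : Matrix (Fin n) (Fin n) 𝕜,
          IsOptimal spectralNorm S X B A ↔
            ∃ Z ∈ c.carrier {i : Fin n // X.rank ≤ (i : ℕ)} 𝕜,
              spectralNorm Z ≤ 1 ∧ A = familyH M X B U Z) ∧
        -- skew-Hermitian matrices are considered over the complex field only
        (c = .skewHerm → (RCLike.I : 𝕜) ≠ 0 → ∀ A : Matrix (Fin n) (Fin n) 𝕜,
          (IsOptimal spectralNorm S X B A ↔
            ∃ G, IsOptimal spectralNorm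
              {G | M * G ∈ MatrixClass.herm.carrier (Fin n) 𝕜} X ((RCLike.I : 𝕜) • B) G ∧
              A = -(RCLike.I : 𝕜) • G) ∧
          (IsOptimal spectralNorm S X B A ↔
            ∃ Z ∈ MatrixClass.herm.carrier {i : Fin n // X.rank ≤ (i : ℕ)} 𝕜,
              spectralNorm Z ≤ 1 ∧
              A = -(RCLike.I : 𝕜) • familyH M X ((RCLike.I : 𝕜) • B) U Z))) := by
  have hdet := isUnit_det_of_mem_unitaryGroup hU
  refine ⟨hS ▸ exists_leftMul_structuredSet_eq hdet hM a, fun c hc => ?_⟩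
  simp only [MatrixClass.carrier_eq_prototype, SetLike.mem_coe] at hc ⊢
  have hε := c.sign_mul_self
  refine ⟨fun A => mem_solutionSet_iff hε hdet hc hne,
    fun A => isOptimal_frobeniusNorm_iff hε hU hc hne,
    ⟨frobeniusNorm_inv_mul_solMap hε hU hc hne,
      by rw [trace_mul_conjTranspose_mul_tr, RCLike.ofReal_im]⟩,
    minNorm_spectralNorm hε hU hc hne, minNorm_spectralNorm_univ hne.some_mem.2,
    fun U s V hsvd => ?_⟩
  simp only [familyT_eq hU, familyH_eq hU]
  have hfamily (A) := isOptimal_spectralNorm_iff (A := A) hε hU hc hne hsvd.isSplitting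
  refine ⟨by rintro (rfl | rfl) <;> exact hfamily, by rintro rfl; exact hfamily, ?_⟩
  rintro rfl hI A
  have hrotated : (solutionSet _ X ((RCLike.I : 𝕜) • B)).Nonempty :=
    ⟨_, (mem_solutionSet_iff_I_smul_mem hI hdet hc).1 hne.some_mem⟩
  simp only [eq_neg_I_smul_iff hI, exists_eq_right', isOptimal_spectralNorm_iff_I_smul hI hdet hc]
  exact ⟨.rfl, isOptimal_spectralNorm_iff rfl hU (leftMul_preimage hdet) hrotated hsvd.isSplitting⟩
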